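/- Let $X,Z$ be topological spaces, $Y\subset Z$, $f:X\to Z$ a continuous map and $C=f^{-1}(Y)$. For $p\ge 0$ let $M_p(C)$ be the set of all closed oriented singular $p$-manifolds in $C$, i.e. continuous maps $s:S\to C$ where $S$ is a closed (compact, without boundary, possibly empty) oriented smooth $p$-manifold. A bordism between closed oriented $p$-manifolds $S_0,S_1$ is a compact oriented smooth $(p+1)$-manifold $W$ with $\partial W=S_0\sqcup(-S_1)$ as oriented manifolds (the boundary being equipped with a collar). Two elements $s_i:S_i\to C$, $i=0,1$, of $M_p(C)$ are Nielsen equivalent, $s_0\sim_N s_1$, if there are a bordism $W$ between $S_0$ and $S_1$, a map $H:W\to X$ extending $s_0\sqcup s_1$, and a map $G:W\to Y$ extending $fs_0\sqcup fs_1$, such that $fH$ and $G$ are homotopic as maps to $Z$ relative to $\partial W=S_0\sqcup S_1$. Let $S'_p(f)=S'_p(f,Y)=M_p(C)/\sim_N$, and write $[s]$ for the class of $s$. Let $F:I\times X\to Z$, $I=[0,1]$, be a homotopy of $f$, i.e. a continuous map with $F(0,x)=f(x)$ for all $x\in X$, define $S'_p(F)=S'_p(F,Y)$ in the same way from $F:I\times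 X\to Z\supset Y$, and let $i:X\to\{0\}\times X\subset I\times X$, $i(x)=(0,x)$, be the inclusion. Theorem. For every $p\ge 0$, $S'_p(f)$ and $S'_p(F)$ are abelian groups under $[s]+[t]=[s\sqcup t]$, and the induced map $i'_*:S'_p(f)\to S'_p(F)$, $i'_*[s]=[is]$, is an injective group homomorphism. -/

import Mathlib

namespace NielsenBordism

open scoped Manifold ContDiff Topology

noncomputable section

/-! ### Orientations of smooth manifolds, possibly with boundary -/

/-- The differential at `x` of the chart of `M` around `x₀`. -/
def chartDeriv {E H M : Type*} [NormedAddCommGroup E] [NormedSpace ℝ E]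
    [TopologicalSpace H] (I : ModelWithCorners ℝ E H) [TopologicalSpace M] [ChartedSpace H M]
    (x₀ x : M) : TangentSpace I x →ₗ[ℝ] E :=
  (mfderiv I 𝓘(ℝ, E) (extChartAt I x₀) x).toLinearMap

/-- A choice `o` of an orientation of every tangent space of an `n`-manifold `M` (modelled on `I`)
is continuous if in the chart around every point it is given, near that point, by one constant
volume form on the model vector space. For `n = 0` this is an arbitrary choice of signs. -/
def IsContinuousOrientation {E H M : Type*} [NormedAddCommGroup E] [NormedSpace ℝ E]
    [TopologicalSpace H] (I : ModelWithCorners ℝ E H) [TopologicalSpace M] [ChartedSpace H M]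
    (n : ℕ) (o : ∀ x : M, Orientation ℝ (TangentSpace I x) (Fin n)) : Prop :=
  ∀ x₀ : M, ∃ η : E [⋀^Fin n]→ₗ[ℝ] ℝ, ∀ᶠ x in 𝓝 x₀,
    ∃ h : η.compLinearMap (chartDeriv I x₀ x) ≠ 0, o x = rayOfNeZero ℝ _ h

/-- The charts of a disjoint union `M ⊔ N` have the same differentials as those of `M`. -/
theorem chartDeriv_inl {p : ℕ} {M N : Type*} [TopologicalSpace M] [TopologicalSpace N]
    [ChartedSpace (EuclideanSpace ℝ (Fin p)) M] [ChartedSpace (EuclideanSpace ℝ (Fin p)) N]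
    [IsManifold (𝓡 p) ∞ M] [IsManifold (𝓡 p) ∞ N] (x₀ x : M)
    (hx : x ∈ (chartAt (EuclideanSpace ℝ (Fin p)) x₀).source) :
    chartDeriv (𝓡 p) (Sum.inl x₀ : M ⊕ N) (Sum.inl x) = chartDeriv (𝓡 p) x₀ x := by
  have : IsManifold (𝓡 p) 1 M := IsManifold.of_le (n := ∞) (by simp)
  have : IsManifold (𝓡 p) 1 N := IsManifold.of_le (n := ∞) (by simp)
  have hx' : (Sum.inl x : M ⊕ N) ∈
      (chartAt (EuclideanSpace ℝ (Fin p)) (Sum.inl x₀ : M ⊕ N)).source := by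
    rw [ChartedSpace.sum_chartAt_inl]
    simpa using hx
  have e : extChartAt (𝓡 p) x₀ = (extChartAt (𝓡 p) (Sum.inl x₀ : M ⊕ N)) ∘ Sum.inl := by
    funext y
    exact extChartAt_inl_apply.symm
  have i := hasMFDerivAt_inl (I := 𝓡 p) (M' := N) (q := x) (p := Sum.inl x)
  have d := HasMFDerivAt.comp x
    (mdifferentiableAt_extChartAt (I := 𝓡 p) hx').hasMFDerivAt i
  rw [← e] at d
  ext v
  simp only [chartDeriv]
  rw [d.mfderiv]
  rfl

/-- The charts of a disjoint union `M ⊔ N` have the same differentials as those of `N`. -/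
theorem chartDeriv_inr {p : ℕ} {M N : Type*} [TopologicalSpace M] [TopologicalSpace N]
    [ChartedSpace (EuclideanSpace ℝ (Fin p)) M] [ChartedSpace (EuclideanSpace ℝ (Fin p)) N]
    [IsManifold (𝓡 p) ∞ M] [IsManifold (𝓡 p) ∞ N] (x₀ x : N)
    (hx : x ∈ (chartAt (EuclideanSpace ℝ (Fin p)) x₀).source) :
    chartDeriv (𝓡 p) (Sum.inr x₀ : M ⊕ N) (Sum.inr x) = chartDeriv (𝓡 p) x₀ x := by
  have : IsManifold (𝓡 p) 1 M := IsManifold.of_le (n := ∞) (by simp)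
  have : IsManifold (𝓡 p) 1 N := IsManifold.of_le (n := ∞) (by simp)
  have hx' : (Sum.inr x : M ⊕ N) ∈
      (chartAt (EuclideanSpace ℝ (Fin p)) (Sum.inr x₀ : M ⊕ N)).source := by
    rw [ChartedSpace.sum_chartAt_inr]
    simpa using hx
  have e : extChartAt (𝓡 p) x₀ = (extChartAt (𝓡 p) (Sum.inr x₀ : M ⊕ N)) ∘ Sum.inr := by
    funext y
    exact extChartAt_inr_apply.symm
  have i := hasMFDerivAt_inr (I := 𝓡 p) (M := M) (q' := x) (p := Sum.inr x)
  have d := HasMFDerivAt.comp x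
    (mdifferentiableAt_extChartAt (I := 𝓡 p) hx').hasMFDerivAt i
  rw [← e] at d
  ext v
  simp only [chartDeriv]
  rw [d.mfderiv]
  rfl

/-! ### Closed oriented manifolds -/

/-- A closed (compact, without boundary) oriented smooth `p`-manifold; it may be empty. -/
structure ClosedManifold (p : ℕ) : Type 1 where
  carrier : Type
  [top : TopologicalSpace carrier]
  [charted : ChartedSpace (EuclideanSpace ℝ (Fin p)) carrier]
  [smooth : IsManifold (𝓡 p) ∞ carrier]
  [compact : CompactSpace carrier]
  [hausdorff : T2Space carrier]
  orient : ∀ x : carrier, Orientation ℝ (TangentSpace (𝓡 p) x) (Fin p)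
  orient_continuous : IsContinuousOrientation (𝓡 p) p orient

attribute [instance] ClosedManifold.top ClosedManifold.charted ClosedManifold.smooth
  ClosedManifold.compact ClosedManifold.hausdorff

namespace ClosedManifold

variable {p : ℕ}

/-- The manifold `-M`: the same manifold with the opposite orientation. -/
def neg (M : ClosedManifold p) : ClosedManifold p where
  carrier := M.carrier
  orient x := -M.orient x
  orient_continuous := by
    intro x₀
    obtain ⟨η, hη⟩ := M.orient_continuous x₀
    refine ⟨-η, hη.mono ?_⟩
    rintro x ⟨h, hx⟩
    have key : (-η).compLinearMap (chartDeriv (𝓡 p) x₀ x) =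
        -(η.compLinearMap (chartDeriv (𝓡 p) x₀ x)) := by
      ext v; simp
    refine ⟨by rw [key]; exact neg_ne_zero.mpr h, ?_⟩
    change -M.orient x = _
    rw [hx, neg_rayOfNeZero]
    simp only [key]

/-- The disjoint union `M ⊔ N`, oriented by the orientations of `M` and `N`. -/
def sum (M N : ClosedManifold p) : ClosedManifold p where
  carrier := M.carrier ⊕ N.carrier
  orient x := match x with
    | Sum.inl x => M.orient x
    | Sum.inr x => N.orient x
  orient_continuous := by
    rintro (x₀ | x₀)
    · obtain ⟨η, hη⟩ := M.orient_continuous x₀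
      refine ⟨η, ?_⟩
      rw [nhds_inl, Filter.eventually_map]
      filter_upwards [hη, (chartAt (EuclideanSpace ℝ (Fin p)) x₀).open_source.mem_nhds
        (mem_chart_source _ x₀)] with x h hx
      rw [chartDeriv_inl x₀ x hx]
      exact h
    · obtain ⟨η, hη⟩ := N.orient_continuous x₀
      refine ⟨η, ?_⟩
      rw [nhds_inr, Filter.eventually_map]
      filter_upwards [hη, (chartAt (EuclideanSpace ℝ (Fin p)) x₀).open_source.mem_nhds
        (mem_chart_source _ x₀)] with x h hx
      rw [chartDeriv_inr x₀ x hx]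
      exact h

end ClosedManifold

/-! ### Compact oriented manifolds with a prescribed boundary -/

/-- The half-space `ℝ^p × [0, ∞)`, on which `(p+1)`-manifolds with boundary are modelled. -/
abbrev HalfSpace (p : ℕ) : Type := ModelProd (EuclideanSpace ℝ (Fin p)) (EuclideanHalfSpace 1)

/-- The vector space `ℝ^p × ℝ` around the half-space `ℝ^p × [0, ∞)`. -/
abbrev HalfSpaceVec (p : ℕ) : Type := EuclideanSpace ℝ (Fin p) × EuclideanSpace ℝ (Fin 1)

/-- The model with corners of the half-space `ℝ^p × [0, ∞)` in `ℝ^p × ℝ`. -/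
abbrev halfModel (p : ℕ) : ModelWithCorners ℝ (HalfSpaceVec p) (HalfSpace p) :=
  (𝓡 p).prod (𝓡∂ 1)

/-- The vector of `ℝ^p × ℝ` that points out of the half-space `ℝ^p × [0, ∞)` orthogonally. -/
def outward (p : ℕ) : HalfSpaceVec p := (0, -EuclideanSpace.single 0 1)

/-- The form `v ↦ η (D ν, D (v₁, 0), …, D (v_p, 0))` on `ℝ^p`, where `ν` is the outward vector:
if `D` is the differential of a collar at a boundary point and `η` represents the orientation of
the manifold there, this form represents the boundary orientation (outward vector first). -/
def boundaryForm {p : ℕ} {T : Type*} [AddCommGroup T] [Module ℝ T]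
    (D : HalfSpaceVec p →ₗ[ℝ] T) (η : T [⋀^Fin (p + 1)]→ₗ[ℝ] ℝ) :
    EuclideanSpace ℝ (Fin p) [⋀^Fin p]→ₗ[ℝ] ℝ :=
  ((η.compLinearMap D).curryLeft (outward p)).compLinearMap
    (LinearMap.inl ℝ (EuclideanSpace ℝ (Fin p)) (EuclideanSpace ℝ (Fin 1)))

/-- A compact oriented smooth `(p+1)`-manifold `W` with (collared) boundary `∂W = N`: the boundary
is identified with the closed oriented `p`-manifold `N` by the restriction to `N × {0}` of a collar,
a diffeomorphism of `N × [0, ∞)` onto an open neighbourhood of `∂W` in `W`, and the orientation of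
`N` is the boundary orientation. -/
structure Filling {p : ℕ} (N : ClosedManifold p) : Type 1 where
  carrier : Type
  [top : TopologicalSpace carrier]
  [charted : ChartedSpace (HalfSpace p) carrier]
  [smooth : IsManifold (halfModel p) ∞ carrier]
  [compact : CompactSpace carrier]
  [hausdorff : T2Space carrier]
  orient : ∀ x : carrier, Orientation ℝ (TangentSpace (halfModel p) x) (Fin (p + 1))
  orient_continuous : IsContinuousOrientation (halfModel p) (p + 1) orient
  collar : N.carrier × EuclideanHalfSpace 1 → carrier
  collar_injective : Function.Injective collar
  collar_diffeo : IsLocalDiffeomorph (halfModel p) (halfModel p) ∞ collar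
  collar_boundary : Set.range (fun x : N.carrier => collar (x, 0)) = (halfModel p).boundary carrier
  collar_orient : ∀ (x : N.carrier)
    (η : TangentSpace (halfModel p) (collar (x, 0)) [⋀^Fin (p + 1)]→ₗ[ℝ] ℝ) (hη : η ≠ 0),
    orient (collar (x, 0)) = rayOfNeZero ℝ η hη →
    ∃ h : boundaryForm
        (mfderiv (halfModel p) (halfModel p) collar (x, 0) :
          HalfSpaceVec p →L[ℝ] TangentSpace (halfModel p) (collar (x, 0))).toLinearMap η ≠ 0,
      N.orient x = rayOfNeZero ℝ _ h

attribute [instance] Filling.top Filling.charted Filling.smooth Filling.compact Filling.hausdorff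

/-- The inclusion `N = ∂W → W` of the boundary. -/
def Filling.bd {p : ℕ} {N : ClosedManifold p} (W : Filling N) (x : N.carrier) : W.carrier :=
  W.collar (x, 0)

/-- A bordism between `M` and `N`: a compact oriented manifold `W` with `∂W = M ⊔ -N`. -/
abbrev Bordism {p : ℕ} (M N : ClosedManifold p) : Type 1 := Filling (M.sum N.neg)

namespace Bordism

variable {p : ℕ} {M N : ClosedManifold p}

/-- The inclusion of the incoming end `M` of a bordism between `M` and `N`. -/
def left (W : Bordism M N) (x : M.carrier) : W.carrier := W.bd (Sum.inl x : M.carrier ⊕ N.carrier)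

/-- The inclusion of the outgoing end `N` of a bordism between `M` and `N`. -/
def right (W : Bordism M N) (x : N.carrier) : W.carrier := W.bd (Sum.inr x : M.carrier ⊕ N.carrier)

end Bordism

/-! ### Singular manifolds and Nielsen classes -/

/-- The set `M_p(A)` of closed oriented singular `p`-manifolds `s : S → A` in a space `A`. -/
structure SingularMfd (p : ℕ) (A : Type*) [TopologicalSpace A] where
  dom : ClosedManifold p
  map : C(dom.carrier, A)

namespace SingularMfd

variable {p : ℕ} {A B : Type*} [TopologicalSpace A] [TopologicalSpace B]

/-- The composition of a singular manifold with a map `k : A → B`. -/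
def push (k : C(A, B)) (s : SingularMfd p A) : SingularMfd p B where
  dom := s.dom
  map := k.comp s.map

/-- The disjoint union `s ⊔ t` of singular manifolds. -/
def sum (s t : SingularMfd p A) : SingularMfd p A where
  dom := s.dom.sum t.dom
  map := ⟨Sum.elim s.map t.map, s.map.continuous.sumElim t.map.continuous⟩

end SingularMfd

section Nielsen

variable {X Z X' Z' : Type*} [TopologicalSpace X] [TopologicalSpace Z]
  [TopologicalSpace X'] [TopologicalSpace Z']

/-- Nielsen equivalence of singular `p`-manifolds `s₀ : S₀ → C` and `s₁ : S₁ → C` in the preimage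
set `C = f⁻¹(Y)`: there are a bordism `W` between `S₀` and `S₁`, a map `H : W → X` extending
`s₀ ⊔ s₁`, and a map `G : W → Y` extending `f s₀ ⊔ f s₁`, such that `f H` and `G` are homotopic,
as maps to `Z`, relative to `∂W = S₀ ⊔ S₁`. -/
def NielsenEquiv (f : C(X, Z)) (Y : Set Z) {p : ℕ} (s₀ s₁ : SingularMfd p (f ⁻¹' Y)) : Prop :=
  ∃ (W : Bordism s₀.dom s₁.dom) (H : C(W.carrier, X)) (G : C(W.carrier, Y)),
    (∀ x, H (W.left x) = s₀.map x) ∧ (∀ x, H (W.right x) = s₁.map x) ∧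
    (∀ x, (G (W.left x) : Z) = f (s₀.map x)) ∧ (∀ x, (G (W.right x) : Z) = f (s₁.map x)) ∧
    ContinuousMap.HomotopicRel (f.comp H)
      (ContinuousMap.comp ⟨Subtype.val, continuous_subtype_val⟩ G)
      (Set.range W.left ∪ Set.range W.right)

/-- `S'_p(f, Y) = M_p(C) / ∼_N`, the Nielsen classes of order `p` of `f`, where `C = f⁻¹(Y)`. -/
def NielsenClasses (f : C(X, Z)) (Y : Set Z) (p : ℕ) : Type _ :=
  Quot (NielsenEquiv f Y (p := p))

/-- The Nielsen class `[s]` of a singular manifold `s` in `f⁻¹(Y)`. -/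
def nielsenClass (f : C(X, Z)) (Y : Set Z) {p : ℕ} (s : SingularMfd p (f ⁻¹' Y)) :
    NielsenClasses f Y p :=
  Quot.mk _ s

/-- A morphism `(k, h)` from the preimage problem `f : X → Z ⊇ Y` to the preimage problem
`f' : X' → Z' ⊇ Y'`, that is, `f' k = h f` and `h(Y) ⊆ Y'`, restricts to a map
`f⁻¹(Y) → f'⁻¹(Y')`. -/
def preimageMap {f : C(X, Z)} {Y : Set Z} {f' : C(X', Z')} {Y' : Set Z'} (k : C(X, X'))
    (h : C(Z, Z')) (comm : ∀ x, f' (k x) = h (f x)) (hY : Set.MapsTo h Y Y') :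
    C(f ⁻¹' Y, f' ⁻¹' Y') where
  toFun x := ⟨k x, by
    have := hY x.2
    rwa [← comm] at this⟩
  continuous_toFun := by fun_prop

/-- Nielsen equivalent singular manifolds have Nielsen equivalent images. -/
theorem NielsenEquiv.push {f : C(X, Z)} {Y : Set Z} {f' : C(X', Z')} {Y' : Set Z'}
    (k : C(X, X')) (h : C(Z, Z')) (comm : ∀ x, f' (k x) = h (f x)) (hY : Set.MapsTo h Y Y')
    {p : ℕ} {s₀ s₁ : SingularMfd p (f ⁻¹' Y)} (hs : NielsenEquiv f Y s₀ s₁) :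
    NielsenEquiv f' Y' (s₀.push (preimageMap k h comm hY)) (s₁.push (preimageMap k h comm hY)) := by
  obtain ⟨W, H, G, h₀, h₁, g₀, g₁, hom⟩ := hs
  refine ⟨W, k.comp H, ⟨fun w => ⟨h (G w), hY (G w).2⟩, by fun_prop⟩, ?_, ?_, ?_, ?_, ?_⟩
  · intro x; exact congrArg k (h₀ x)
  · intro x; exact congrArg k (h₁ x)
  · intro x; exact (congrArg h (g₀ x)).trans (comm _).symm
  · intro x; exact (congrArg h (g₁ x)).trans (comm _).symm
  · have e : f'.comp (k.comp H) = h.comp (f.comp H) := by ext x; exact comm _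
    rw [e]
    exact hom.map (·.compContinuousMap h)

/-- The map `k'_* : S'_p(f, Y) → S'_p(f', Y')`, `k'_*[s] = [k s]`, induced by a morphism `(k, h)`
of preimage problems. -/
def inducedMap {f : C(X, Z)} {Y : Set Z} {f' : C(X', Z')} {Y' : Set Z'} (k : C(X, X'))
    (h : C(Z, Z')) (comm : ∀ x, f' (k x) = h (f x)) (hY : Set.MapsTo h Y Y') (p : ℕ) :
    NielsenClasses f Y p → NielsenClasses f' Y' p :=
  Quot.map (SingularMfd.push (preimageMap k h comm hY))
    fun _ _ hs => hs.push k h comm hY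

end Nielsen

/-- The inclusion `i : X → {0} × X ⊆ I × X`. -/
def inclZero (X : Type*) [TopologicalSpace X] : C(X, unitInterval × X) := ⟨fun x => (0, x), by fun_prop⟩

end

end NielsenBordism

open NielsenBordism

/-! Let `E` be the homotopy preimage of `Y` under `f`: triples of a point `x` of `X`, a point `y` of
`Y` and a path in `Z` from `f x` to `y`. A triple `(H, G, homotopy)` on a bordism `W` is the same
thing as one map from `W` to `E`, and the homotopy is relative to the boundary exactly when the
boundary is sent to constant paths. So Nielsen equivalence is ordinary oriented bordism in `E` of
singular manifolds pushed forward along the inclusion `constPath` of `C`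
(`nielsenEquiv_iff_bordant`), and the group structure reduces to that of oriented bordism.

Bordism is phrased through `Bounds`: `s` and `t` are bordant when `s ⊔ -t` bounds. Two geometric
facts carry everything: `s ⊔ -s` bounds a cylinder (`bounds_sum_neg`), and if `s ⊔ (t ⊔ -t)` bounds
then so does `s` (`Bounds.glue`). The first gives reflexivity and inverses, the second transitivity;
the rest is rearrangement of disjoint unions. Both facts come from `exists_oriented_quotient`, which
divides an oriented manifold by a closed, fixed-point-free partial involution given locally by
oriented diffeomorphisms. The cylinder is `(M ⊔ -M) × [0, ∞)` modulo `(x, t) ~ (swap x, 1/t)`. For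
gluing, the boundary pieces `M` and `-M` are deleted and their open collars identified by `(b, t) ~
(swap b, 1 - t)`. All identifications thus take place over open sets, and no smooth structure has to
be built along a seam. In both cases `swap` and the map of the half-line each reverse orientation,
so their product preserves it.

Injectivity: let `H = (τ, H')` be the map from `W` to `I × X` of an equivalence for `F`. The
homotopy `F(r τ, H')` goes from `f H'` to `F H`, and it is stationary on the boundary because `τ =
0` there. Followed by the given homotopy from `F H` to `G`, it is an equivalence for `f`. -/

namespace NielsenBordism

open scoped Manifold ContDiff Topology

noncomputable section

/-! ### Pulling back orientations along linear maps -/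

section Pulls

variable {n : ℕ} {T T' U : Type*} [AddCommGroup T] [Module ℝ T] [AddCommGroup T'] [Module ℝ T']
  [AddCommGroup U] [Module ℝ U]

/-- The orientation `o` is the pull-back of the orientation `o'` along the linear map `D`. -/
def Pulls (D : T →ₗ[ℝ] T') (o' : Orientation ℝ T' (Fin n)) (o : Orientation ℝ T (Fin n)) : Prop :=
  ∀ (η : T' [⋀^Fin n]→ₗ[ℝ] ℝ) (hη : η ≠ 0), o' = rayOfNeZero ℝ η hη →
    ∃ h : η.compLinearMap D ≠ 0, o = rayOfNeZero ℝ _ h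

theorem exists_pos_smul_of_ray_eq {V : Type*} [AddCommGroup V] [Module ℝ V] {v w : V}
    {hv : v ≠ 0} {hw : w ≠ 0} (h : rayOfNeZero ℝ v hv = rayOfNeZero ℝ w hw) :
    ∃ c : ℝ, 0 < c ∧ v = c • w := by
  obtain ⟨r, hr, h⟩ := ((ray_eq_iff hv hw).1 h).exists_pos_right hv hw
  exact ⟨r, hr, h⟩

theorem ray_eq_of_pos_smul {V : Type*} [AddCommGroup V] [Module ℝ V] {v w : V}
    (hv : v ≠ 0) (hw : w ≠ 0) {c : ℝ} (hc : 0 < c) (h : v = c • w) :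
    rayOfNeZero ℝ v hv = rayOfNeZero ℝ w hw := by
  rw [ray_eq_iff, h]
  exact SameRay.sameRay_pos_smul_left w hc

/-- Forms representing the same orientation are positive multiples of each other, so testing a
single representative suffices. -/
theorem pulls_of_exists {D : T →ₗ[ℝ] T'} {o' : Orientation ℝ T' (Fin n)}
    {o : Orientation ℝ T (Fin n)} (η : T' [⋀^Fin n]→ₗ[ℝ] ℝ) (hη : η ≠ 0)
    (h : η.compLinearMap D ≠ 0) (ho' : o' = rayOfNeZero ℝ η hη) (ho : o = rayOfNeZero ℝ _ h) :
    Pulls D o' o := by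
  intro ζ hζ hz
  obtain ⟨c, hc, e⟩ := exists_pos_smul_of_ray_eq (hz.symm.trans ho')
  have e' : ζ.compLinearMap D = c • η.compLinearMap D := by subst e; rfl
  have h' : ζ.compLinearMap D ≠ 0 := by rw [e']; exact smul_ne_zero hc.ne' h
  exact ⟨h', ho.trans (ray_eq_of_pos_smul h' h hc e').symm⟩

theorem Pulls.comp {D : T →ₗ[ℝ] T'} {D' : T' →ₗ[ℝ] U} {o : Orientation ℝ T (Fin n)}
    {o' : Orientation ℝ T' (Fin n)} {o'' : Orientation ℝ U (Fin n)}
    (h' : Pulls D' o'' o') (h : Pulls D o' o) : Pulls (D' ∘ₗ D) o'' o := by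
  intro η hη e
  obtain ⟨h₁, e₁⟩ := h' η hη e
  exact h _ h₁ e₁

theorem Pulls.neg {D : T →ₗ[ℝ] T'} {o : Orientation ℝ T (Fin n)} {o' : Orientation ℝ T' (Fin n)}
    (h : Pulls D o' o) : Pulls D (-o') (-o) := by
  induction o' using Module.Ray.ind with | h ζ hζ =>
  obtain ⟨h₁, e₁⟩ := h ζ hζ rfl
  have e : (-ζ).compLinearMap D = -ζ.compLinearMap D := by ext v; simp
  refine pulls_of_exists (-ζ) (neg_ne_zero.2 hζ) (by rw [e]; exact neg_ne_zero.2 h₁)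
    (neg_rayOfNeZero _ _ _) ?_
  rw [e₁, neg_rayOfNeZero]
  simp only [e]

theorem pulls_id (o : Orientation ℝ T (Fin n)) : Pulls LinearMap.id o o := by
  intro η hη e
  exact ⟨by simpa using hη, by simpa using e⟩

/-- Pulling `ζ ∘ D` back along `D'` returns `ζ`, so a one-sided inverse is enough. -/
theorem Pulls.symm {D : T →ₗ[ℝ] T'} {D' : T' →ₗ[ℝ] T} {o : Orientation ℝ T (Fin n)}
    {o' : Orientation ℝ T' (Fin n)} (h : Pulls D o' o) (hD : D ∘ₗ D' = LinearMap.id) :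
    Pulls D' o o' := by
  induction o' using Module.Ray.ind with | h ζ hζ =>
  obtain ⟨h₁, e₁⟩ := h ζ hζ rfl
  have e : (ζ.compLinearMap D).compLinearMap D' = ζ := by
    rw [AlternatingMap.compLinearMap_assoc, hD, AlternatingMap.compLinearMap_id]
  refine pulls_of_exists _ h₁ (by rw [e]; exact hζ) e₁ ?_
  simp only [e]

theorem Pulls.unique_right {D : T →ₗ[ℝ] T'} {o₁ o₂ : Orientation ℝ T (Fin n)}
    {o' : Orientation ℝ T' (Fin n)} (h₁ : Pulls D o' o₁) (h₂ : Pulls D o' o₂) : o₁ = o₂ := by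
  induction o' using Module.Ray.ind with | h ζ hζ =>
  obtain ⟨_, e₁⟩ := h₁ ζ hζ rfl
  obtain ⟨_, e₂⟩ := h₂ ζ hζ rfl
  rw [e₁, e₂]

theorem Pulls.unique_left {D : T →ₗ[ℝ] T'} {D' : T' →ₗ[ℝ] T} {o : Orientation ℝ T (Fin n)}
    {o₁ o₂ : Orientation ℝ T' (Fin n)} (h₁ : Pulls D o₁ o) (h₂ : Pulls D o₂ o)
    (hD : D ∘ₗ D' = LinearMap.id) : o₁ = o₂ :=
  (h₁.symm hD).unique_right (h₂.symm hD)

theorem exists_pulls (D : T →ₗ[ℝ] T') {D' : T' →ₗ[ℝ] T} (hD : D ∘ₗ D' = LinearMap.id)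
    (o' : Orientation ℝ T' (Fin n)) : ∃ o : Orientation ℝ T (Fin n), Pulls D o' o := by
  induction o' using Module.Ray.ind with | h ζ hζ =>
  have e : (ζ.compLinearMap D).compLinearMap D' = ζ := by
    rw [AlternatingMap.compLinearMap_assoc, hD, AlternatingMap.compLinearMap_id]
  have h : ζ.compLinearMap D ≠ 0 := by
    intro h
    rw [h] at e
    exact hζ (by rw [← e]; rfl)
  exact ⟨_, pulls_of_exists ζ hζ h rfl rfl⟩

end Pulls

/-! ### Forms of top degree -/

section TopForms

variable {n : ℕ} {E : Type*} [AddCommGroup E] [Module ℝ E] [FiniteDimensional ℝ E]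

theorem compLinearMap_eq_det_smul (hn : Module.finrank ℝ E = n) (η : E [⋀^Fin n]→ₗ[ℝ] ℝ)
    (f : E →ₗ[ℝ] E) : η.compLinearMap f = LinearMap.det f • η := by
  let b := Module.finBasisOfFinrankEq ℝ E hn
  rw [η.eq_smul_basis_det b]
  ext v
  simp only [AlternatingMap.compLinearMap_apply, AlternatingMap.smul_apply]
  have := b.det_comp f v
  rw [show (fun i => f (v i)) = f ∘ v from rfl, this]
  simp only [smul_eq_mul]
  ring

theorem exists_eq_smul_of_topForm (hn : Module.finrank ℝ E = n) (η ξ : E [⋀^Fin n]→ₗ[ℝ] ℝ)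
    (hξ : ξ ≠ 0) : ∃ c : ℝ, η = c • ξ := by
  let b := Module.finBasisOfFinrankEq ℝ E hn
  have h : ξ b ≠ 0 := (ξ.map_basis_ne_zero_iff b).2 hξ
  refine ⟨η b / ξ b, ?_⟩
  nth_rewrite 1 [η.eq_smul_basis_det b]
  nth_rewrite 2 [ξ.eq_smul_basis_det b]
  rw [smul_smul, div_mul_cancel₀ _ h]

end TopForms

/-! ### Orientations of `ℝ^p × ℝ` with a prescribed boundary -/

section Wedge

variable {p : ℕ}

/-- The exterior product of the outward covector of the half-space with a form on `ℝ^p`. -/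
def outwardWedge (α : EuclideanSpace ℝ (Fin p) [⋀^Fin p]→ₗ[ℝ] ℝ) :
    HalfSpaceVec p [⋀^Fin (p + 1)]→ₗ[ℝ] ℝ :=
  AlternatingMap.alternatizeUncurryFin
    { toFun := fun v => (-(v.2 0)) • α.compLinearMap
        (LinearMap.fst ℝ (EuclideanSpace ℝ (Fin p)) (EuclideanSpace ℝ (Fin 1)))
      map_add' := fun v w => by
        rw [← add_smul]; congr 1; simp; ring
      map_smul' := fun c v => by
        rw [smul_smul]; congr 1; simp }

theorem outwardWedge_apply (α : EuclideanSpace ℝ (Fin p) [⋀^Fin p]→ₗ[ℝ] ℝ)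
    (v : Fin (p + 1) → HalfSpaceVec p) :
    outwardWedge α v =
      ∑ i : Fin (p + 1), (-1) ^ (i : ℕ) • (-((v i).2 0) * α fun j => (i.removeNth v j).1) := by
  rw [outwardWedge, AlternatingMap.alternatizeUncurryFin_apply]
  rfl

/-- In the alternating sum only the term pairing the outward covector with the outward vector
survives; the other arguments have zero second component. -/
theorem boundaryForm_outwardWedge (α : EuclideanSpace ℝ (Fin p) [⋀^Fin p]→ₗ[ℝ] ℝ) :
    boundaryForm LinearMap.id (outwardWedge α) = α := by
  ext v
  have : boundaryForm LinearMap.id (outwardWedge α) v =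
      outwardWedge α (Matrix.vecCons (outward p) fun i => (v i, 0)) := rfl
  rw [this, outwardWedge_apply, Fin.sum_univ_succ]
  simp [outward, Fin.removeNth]

theorem boundaryForm_smul {T : Type*} [AddCommGroup T] [Module ℝ T]
    (D : HalfSpaceVec p →ₗ[ℝ] T) (c : ℝ) (η : T [⋀^Fin (p + 1)]→ₗ[ℝ] ℝ) :
    boundaryForm D (c • η) = c • boundaryForm D η := by
  ext v; rfl

theorem outwardWedge_smul (c : ℝ) (α : EuclideanSpace ℝ (Fin p) [⋀^Fin p]→ₗ[ℝ] ℝ) :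
    outwardWedge (c • α) = c • outwardWedge α := by
  ext v
  simp only [outwardWedge_apply, AlternatingMap.smul_apply, smul_eq_mul, Finset.mul_sum, zsmul_eq_mul]
  refine Finset.sum_congr rfl fun i _ => ?_
  ring

theorem outwardWedge_ne_zero {α : EuclideanSpace ℝ (Fin p) [⋀^Fin p]→ₗ[ℝ] ℝ} (h : α ≠ 0) :
    outwardWedge α ≠ 0 := by
  intro h'
  apply h
  rw [← boundaryForm_outwardWedge α, h']
  rfl

/-- A block-diagonal map scales the outward covector by `a`, so the sign of `a` together with the
effect of `A` decides what happens to product orientations. -/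
theorem outwardWedge_compLinearMap (α : EuclideanSpace ℝ (Fin p) [⋀^Fin p]→ₗ[ℝ] ℝ)
    (D : HalfSpaceVec p →ₗ[ℝ] HalfSpaceVec p)
    (A : EuclideanSpace ℝ (Fin p) →ₗ[ℝ] EuclideanSpace ℝ (Fin p)) (a : ℝ)
    (hD : ∀ v w, D (v, w) = (A v, a • w)) :
    (outwardWedge α).compLinearMap D = a • outwardWedge (α.compLinearMap A) := by
  ext v
  simp only [AlternatingMap.compLinearMap_apply, outwardWedge_apply, AlternatingMap.smul_apply,
    smul_eq_mul, Finset.mul_sum, zsmul_eq_mul]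
  refine Finset.sum_congr rfl fun i _ => ?_
  have h (v : HalfSpaceVec p) : D v = (A v.1, a • v.2) := hD v.1 v.2
  simp only [h, Fin.removeNth]
  simp
  ring

/-- The orientation of `ℝ^p × [0, ∞)` whose boundary orientation is `o`. -/
def prodOr (o : Orientation ℝ (EuclideanSpace ℝ (Fin p)) (Fin p)) :
    Orientation ℝ (HalfSpaceVec p) (Fin (p + 1)) :=
  rayOfNeZero ℝ (outwardWedge o.someVector) (outwardWedge_ne_zero o.someVector_ne_zero)

theorem prodOr_rayOfNeZero (α : EuclideanSpace ℝ (Fin p) [⋀^Fin p]→ₗ[ℝ] ℝ) (h : α ≠ 0) :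
    prodOr (rayOfNeZero ℝ α h) = rayOfNeZero ℝ _ (outwardWedge_ne_zero h) := by
  obtain ⟨c, hc, e⟩ := exists_pos_smul_of_ray_eq (Module.Ray.someVector_ray (rayOfNeZero ℝ α h))
  refine ray_eq_of_pos_smul _ _ hc ?_
  nth_rewrite 1 [e]
  exact outwardWedge_smul _ _

theorem prodOr_neg (o : Orientation ℝ (EuclideanSpace ℝ (Fin p)) (Fin p)) :
    prodOr (-o) = -prodOr o := by
  induction o using Module.Ray.ind with | h α h =>
  have e : outwardWedge (-α) = -outwardWedge α := by
    ext v
    simp [outwardWedge_apply]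
  rw [neg_rayOfNeZero, prodOr_rayOfNeZero, prodOr_rayOfNeZero, neg_rayOfNeZero]
  simp only [e]

theorem Pulls.prodOr_pos {A : EuclideanSpace ℝ (Fin p) →ₗ[ℝ] EuclideanSpace ℝ (Fin p)}
    {o o' : Orientation ℝ (EuclideanSpace ℝ (Fin p)) (Fin p)} (h : Pulls A o' o)
    {D : HalfSpaceVec p →ₗ[ℝ] HalfSpaceVec p} {a : ℝ} (ha : 0 < a)
    (hD : ∀ v w, D (v, w) = (A v, a • w)) : Pulls D (prodOr o') (prodOr o) := by
  induction o' using Module.Ray.ind with | h α hα =>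
  obtain ⟨h₁, e₁⟩ := h α hα rfl
  have e := outwardWedge_compLinearMap α D A a hD
  have hne : (outwardWedge α).compLinearMap D ≠ 0 := by
    rw [e]; exact smul_ne_zero ha.ne' (outwardWedge_ne_zero h₁)
  refine pulls_of_exists _ (outwardWedge_ne_zero hα) hne (prodOr_rayOfNeZero _ _) ?_
  rw [e₁, prodOr_rayOfNeZero]
  exact (ray_eq_of_pos_smul _ _ ha e).symm

/-- Two reversals cancel: `A` reverses the orientation of the first factor and `a < 0` that of the
second. This is the sign computation behind both the cylinder and the gluing. -/
theorem Pulls.prodOr_neg {A : EuclideanSpace ℝ (Fin p) →ₗ[ℝ] EuclideanSpace ℝ (Fin p)}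
    {o o' : Orientation ℝ (EuclideanSpace ℝ (Fin p)) (Fin p)} (h : Pulls A o' (-o))
    {D : HalfSpaceVec p →ₗ[ℝ] HalfSpaceVec p} {a : ℝ} (ha : a < 0)
    (hD : ∀ v w, D (v, w) = (A v, a • w)) : Pulls D (prodOr o') (prodOr o) := by
  induction o' using Module.Ray.ind with | h α hα =>
  obtain ⟨h₁, e₁⟩ := h α hα rfl
  have e := outwardWedge_compLinearMap α D A a hD
  have hne : (outwardWedge α).compLinearMap D ≠ 0 := by
    rw [e]; exact smul_ne_zero ha.ne (outwardWedge_ne_zero h₁)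
  refine pulls_of_exists _ (outwardWedge_ne_zero hα) hne (prodOr_rayOfNeZero _ _) ?_
  rw [← neg_neg o, e₁, NielsenBordism.prodOr_neg, prodOr_rayOfNeZero, neg_rayOfNeZero]
  refine (ray_eq_of_pos_smul _ _ (neg_pos.2 ha) ?_).symm
  rw [e, neg_smul_neg]

theorem finrank_halfSpaceVec : Module.finrank ℝ (HalfSpaceVec p) = p + 1 := by simp

/-- An orientation of `T` restricts to the boundary orientation `o` if and only if it pulls back to
the product orientation. -/
theorem boundaryForm_iff_pulls {T : Type*} [AddCommGroup T] [Module ℝ T]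
    {D : HalfSpaceVec p →ₗ[ℝ] T}
    {μ : Orientation ℝ T (Fin (p + 1))} {o : Orientation ℝ (EuclideanSpace ℝ (Fin p)) (Fin p)} :
    (∀ (η : T [⋀^Fin (p + 1)]→ₗ[ℝ] ℝ) (hη : η ≠ 0), μ = rayOfNeZero ℝ η hη →
      ∃ h : boundaryForm D η ≠ 0, o = rayOfNeZero ℝ _ h) ↔ Pulls D μ (prodOr o) := by
  induction o using Module.Ray.ind with | h α hα =>
  have hw := outwardWedge_ne_zero hα
  -- Top forms are proportional, so one scalar `c` compares both the pull-back with the wedge and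
  -- the boundary form with `α`. Each of the two conditions says that `c` is positive.
  have key (η : T [⋀^Fin (p + 1)]→ₗ[ℝ] ℝ) : ∃ c : ℝ,
      η.compLinearMap D = c • outwardWedge α ∧ boundaryForm D η = c • α := by
    obtain ⟨c, hc⟩ := exists_eq_smul_of_topForm finrank_halfSpaceVec (η.compLinearMap D)
      (outwardWedge α) hw
    refine ⟨c, hc, ?_⟩
    have : boundaryForm D η = boundaryForm LinearMap.id (η.compLinearMap D) := rfl
    rw [this, hc, boundaryForm_smul, boundaryForm_outwardWedge]
  constructor
  · intro h η hη e
    obtain ⟨c, h₁, h₂⟩ := key η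
    obtain ⟨h₃, h₄⟩ := h η hη e
    obtain ⟨d, hd, h₅⟩ := exists_pos_smul_of_ray_eq h₄.symm
    have hcd : c = d := by
      have : c • α = d • α := by rw [← h₂, h₅]
      exact smul_left_injective ℝ hα this
    subst hcd
    have hne : η.compLinearMap D ≠ 0 := by rw [h₁]; exact smul_ne_zero hd.ne' hw
    refine ⟨hne, ?_⟩
    rw [prodOr_rayOfNeZero]
    exact (ray_eq_of_pos_smul _ _ hd h₁).symm
  · intro h η hη e
    obtain ⟨c, h₁, h₂⟩ := key η
    obtain ⟨h₃, h₄⟩ := h η hη e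
    rw [prodOr_rayOfNeZero] at h₄
    obtain ⟨d, hd, h₅⟩ := exists_pos_smul_of_ray_eq h₄.symm
    have hcd : c = d := by
      have : c • outwardWedge α = d • outwardWedge α := by rw [← h₁, h₅]
      exact smul_left_injective ℝ hw this
    subst hcd
    have hne : boundaryForm D η ≠ 0 := by rw [h₂]; exact smul_ne_zero hd.ne' hα
    exact ⟨hne, (ray_eq_of_pos_smul _ _ hd h₂).symm⟩

end Wedge

/-! ### Local diffeomorphisms -/

section LocalDiffeo

open Set Filter

variable {E H E' H' E'' H'' : Type*} [NormedAddCommGroup E] [NormedSpace ℝ E] [TopologicalSpace H]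
  {I : ModelWithCorners ℝ E H} [NormedAddCommGroup E'] [NormedSpace ℝ E'] [TopologicalSpace H']
  {I' : ModelWithCorners ℝ E' H'} [NormedAddCommGroup E''] [NormedSpace ℝ E'']
  [TopologicalSpace H''] {I'' : ModelWithCorners ℝ E'' H''}
  {M N P : Type*} [TopologicalSpace M] [ChartedSpace H M] [TopologicalSpace N] [ChartedSpace H' N]
  [TopologicalSpace P] [ChartedSpace H'' P]
  {n : WithTop ℕ∞}

/-- Total functions controlled only near `x` and `f x` suffice: cutting the two neighbourhoods down
to `U ∩ f ⁻¹' V` and `V ∩ g ⁻¹' U` makes `f` and `g` exchange them. -/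
theorem isLocalDiffeomorphAt_of_eventually {f : M → N} {g : N → M} {x : M}
    (hf : ∀ᶠ y in 𝓝 x, ContMDiffAt I I' n f y ∧ g (f y) = y)
    (hg : ∀ᶠ y in 𝓝 (f x), ContMDiffAt I' I n g y ∧ f (g y) = y) :
    IsLocalDiffeomorphAt I I' n f x := by
  obtain ⟨U, hU, hUo, hxU⟩ := eventually_nhds_iff.1 hf
  obtain ⟨V, hV, hVo, hxV⟩ := eventually_nhds_iff.1 hg
  have cf : ContinuousOn f U := fun y hy => (hU y hy).1.continuousAt.continuousWithinAt
  have cg : ContinuousOn g V := fun y hy => (hV y hy).1.continuousAt.continuousWithinAt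
  refine ⟨{ toFun := f
            invFun := g
            source := U ∩ f ⁻¹' V
            target := V ∩ g ⁻¹' U
            map_source' := ?_
            map_target' := ?_
            left_inv' := fun y hy => (hU y hy.1).2
            right_inv' := fun y hy => (hV y hy.1).2
            open_source := cf.isOpen_inter_preimage hUo hVo
            open_target := cg.isOpen_inter_preimage hVo hUo
            contMDiffOn_toFun := fun y hy => (hU y hy.1).1.contMDiffWithinAt
            contMDiffOn_invFun := fun y hy => (hV y hy.1).1.contMDiffWithinAt },
      ⟨hxU, hxV⟩, fun y _ => rfl⟩
  · rintro y ⟨hy, hy'⟩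
    exact ⟨hy', by simpa only [mem_preimage, (hU y hy).2] using hy⟩
  · rintro y ⟨hy, hy'⟩
    exact ⟨hy', by simpa only [mem_preimage, (hV y hy).2] using hy⟩

theorem _root_.IsLocalDiffeomorphAt.eventually {f : M → N} {x : M}
    (h : IsLocalDiffeomorphAt I I' n f x) : ∀ᶠ y in 𝓝 x, IsLocalDiffeomorphAt I I' n f y := by
  obtain ⟨Φ, hx, e⟩ := h
  filter_upwards [Φ.open_source.mem_nhds hx] with y hy
  exact ⟨Φ, hy, e⟩

theorem _root_.IsLocalDiffeomorphAt.congr {f g : M → N} {x : M}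
    (h : IsLocalDiffeomorphAt I I' n f x) (e : f =ᶠ[𝓝 x] g) : IsLocalDiffeomorphAt I I' n g x := by
  have e₀ : f x = g x := e.eq_of_nhds
  refine isLocalDiffeomorphAt_of_eventually (g := h.localInverse) ?_ ?_
  · filter_upwards [h.eventually, e.eventuallyEq_nhds, e,
      h.localInverse.open_target.mem_nhds h.localInverse_mem_target] with y h₁ h₂ h₃ h₄
    exact ⟨h₁.contMDiffAt.congr_of_eventuallyEq h₂.symm, by
      rw [← h₃]; exact h.localInverse_left_inv h₄⟩
  · have c : Tendsto h.localInverse (𝓝 (f x)) (𝓝 x) := by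
      have := h.localInverse_contMDiffAt.continuousAt
      rwa [ContinuousAt, h.localInverse_left_inv h.localInverse_mem_target] at this
    rw [← e₀]
    filter_upwards [h.localInverse.open_source.mem_nhds h.localInverse_mem_source, c.eventually e]
      with y h₁ h₂
    exact ⟨h.localInverse_contMDiffOn.contMDiffAt (h.localInverse.open_source.mem_nhds h₁), by
      rw [← h₂]; exact h.localInverse_right_inv h₁⟩

theorem _root_.IsLocalDiffeomorphAt.trans {f : M → N} {g : N → P} {x : M}
    (hf : IsLocalDiffeomorphAt I I' n f x) (hg : IsLocalDiffeomorphAt I' I'' n g (f x)) :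
    IsLocalDiffeomorphAt I I'' n (g ∘ f) x :=
  IsLocalDiffeomorphAt.comp _ _ hf hg

theorem _root_.IsLocalDiffeomorphAt.of_comp_right {f : M → N} {g : N → P} {x : M}
    (hf : IsLocalDiffeomorphAt I I' n f x) (hgf : IsLocalDiffeomorphAt I I'' n (g ∘ f) x) :
    IsLocalDiffeomorphAt I' I'' n g (f x) := by
  have h := hf.localInverse_isLocalDiffeomorphAt
  have e := hf.localInverse_left_inv hf.localInverse_mem_target
  refine (h.trans (g := g ∘ f) (by rwa [e])).congr ?_
  filter_upwards [hf.localInverse.open_source.mem_nhds hf.localInverse_mem_source] with y hy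
  exact congrArg g (hf.localInverse_right_inv hy)

/-- Near `x`, `f` is the local inverse of `g` applied to `g ∘ f`. Continuity keeps `f` on that
branch of the inverse. -/
theorem _root_.IsLocalDiffeomorphAt.of_comp_left {f : M → N} {g : N → P} {x : M}
    (hg : IsLocalDiffeomorphAt I' I'' n g (f x)) (hgf : IsLocalDiffeomorphAt I I'' n (g ∘ f) x)
    (hf : ContinuousAt f x) : IsLocalDiffeomorphAt I I' n f x := by
  have h := hg.localInverse_isLocalDiffeomorphAt
  refine (hgf.trans h).congr ?_
  filter_upwards [hf.preimage_mem_nhds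
    (hg.localInverse.open_target.mem_nhds hg.localInverse_mem_target)] with y hy
  exact hg.localInverse_left_inv hy

theorem _root_.IsLocalDiffeomorphAt.map_nhds {f : M → N} {x : M}
    (h : IsLocalDiffeomorphAt I I' n f x) : map f (𝓝 x) = 𝓝 (f x) := by
  obtain ⟨Φ, hx, e⟩ := h
  rw [map_congr (e.eventuallyEq_of_mem (Φ.open_source.mem_nhds hx)), e hx]
  exact Φ.toOpenPartialHomeomorph.map_nhds_eq hx

theorem isLocalDiffeomorphAt_id (x : M) : IsLocalDiffeomorphAt I I n (id : M → M) x :=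
  isLocalDiffeomorphAt_of_eventually (g := id) (Eventually.of_forall fun _ => ⟨contMDiffAt_id, rfl⟩)
    (Eventually.of_forall fun _ => ⟨contMDiffAt_id, rfl⟩)

theorem isLocalDiffeomorphAt_subtypeVal (U : TopologicalSpace.Opens M) (x : U) :
    IsLocalDiffeomorphAt I I ∞ (Subtype.val : U → M) x := by
  classical
  -- The default value `x` off `U` is never seen: the inverse matters only near `x`, inside the open
  -- set `U`.
  let g : M → U := fun y => if h : y ∈ U then ⟨y, h⟩ else x
  have hg (y : M) (hy : y ∈ U) : (g y : M) = y := by simp [g, hy]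
  refine isLocalDiffeomorphAt_of_eventually (g := g)
    (Eventually.of_forall fun y => ⟨contMDiff_subtype_val y, Subtype.ext (hg y y.2)⟩) ?_
  filter_upwards [U.isOpen.mem_nhds x.2] with y hy
  refine ⟨?_, hg y hy⟩
  rw [← ContMDiffAt.subtypeVal_comp_iff]
  refine contMDiffAt_id.congr_of_eventuallyEq ?_
  filter_upwards [U.isOpen.mem_nhds hy] with z hz
  exact hg z hz

variable {M₁ N₁ : Type*} [TopologicalSpace M₁] [ChartedSpace H M₁]

theorem isLocalDiffeomorphAt_inl (x : M) :
    IsLocalDiffeomorphAt I I n (Sum.inl : M → M ⊕ M₁) x := by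
  refine isLocalDiffeomorphAt_of_eventually (g := Sum.elim id fun _ => x)
    (Eventually.of_forall fun y => ⟨ContMDiff.inl y, rfl⟩) ?_
  rw [nhds_inl, eventually_map]
  exact Eventually.of_forall fun y =>
    ⟨ContMDiff.sumElim contMDiff_id contMDiff_const (Sum.inl y), rfl⟩

theorem isLocalDiffeomorphAt_inr (x : M₁) :
    IsLocalDiffeomorphAt I I n (Sum.inr : M₁ → M ⊕ M₁) x := by
  refine isLocalDiffeomorphAt_of_eventually (g := Sum.elim (fun _ => x) id)
    (Eventually.of_forall fun y => ⟨ContMDiff.inr y, rfl⟩) ?_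
  rw [nhds_inr, eventually_map]
  exact Eventually.of_forall fun y =>
    ⟨ContMDiff.sumElim contMDiff_const contMDiff_id (Sum.inr y), rfl⟩

variable [TopologicalSpace N₁] [ChartedSpace H'' N₁]

theorem _root_.IsLocalDiffeomorphAt.prodMap {H₃ E₃ : Type*} [NormedAddCommGroup E₃]
    [NormedSpace ℝ E₃] [TopologicalSpace H₃] {I₃ : ModelWithCorners ℝ E₃ H₃} {Q : Type*}
    [TopologicalSpace Q] [ChartedSpace H₃ Q] {f : M → N} {g : P → Q} {x : M} {y : P}
    (hf : IsLocalDiffeomorphAt I I' n f x) (hg : IsLocalDiffeomorphAt I'' I₃ n g y) :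
    IsLocalDiffeomorphAt (I.prod I'') (I'.prod I₃) n (Prod.map f g) (x, y) := by
  obtain ⟨Φ, hx, e⟩ := hf
  obtain ⟨Ψ, hy, e'⟩ := hg
  refine ⟨{ toPartialEquiv := Φ.toPartialEquiv.prod Ψ.toPartialEquiv
            open_source := Φ.open_source.prod Ψ.open_source
            open_target := Φ.open_target.prod Ψ.open_target
            contMDiffOn_toFun := Φ.contMDiffOn_toFun.prodMap Ψ.contMDiffOn_toFun
            contMDiffOn_invFun := Φ.contMDiffOn_invFun.prodMap Ψ.contMDiffOn_invFun },
    ⟨hx, hy⟩, ?_⟩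
  rintro ⟨a, b⟩ ⟨ha, hb⟩
  exact Prod.ext (e ha) (e' hb)

theorem _root_.IsLocalDiffeomorphAt.exists_rightInverse_mfderiv {f : M → N} {x : M}
    (h : IsLocalDiffeomorphAt I I' n f x) (hn : n ≠ 0) :
    ∃ D : TangentSpace I' (f x) →ₗ[ℝ] TangentSpace I x,
      (mfderiv I I' f x).toLinearMap ∘ₗ D = LinearMap.id ∧
      D ∘ₗ (mfderiv I I' f x).toLinearMap = LinearMap.id := by
  refine ⟨((h.mfderivToContinuousLinearEquiv hn).symm : _ →L[ℝ] _).toLinearMap, ?_, ?_⟩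
  · ext v
    exact (h.mfderivToContinuousLinearEquiv hn).apply_symm_apply v
  · ext v
    exact (h.mfderivToContinuousLinearEquiv hn).symm_apply_apply v

end LocalDiffeo

/-! ### Orientation preserving local diffeomorphisms -/

section Oriented

open Set Filter

variable {n : ℕ} {E H : Type*} [NormedAddCommGroup E] [NormedSpace ℝ E] [TopologicalSpace H]
  {I : ModelWithCorners ℝ E H}
  {M N P : Type*} [TopologicalSpace M] [ChartedSpace H M] [TopologicalSpace N] [ChartedSpace H N]
  [TopologicalSpace P] [ChartedSpace H P]

/-- The differential of a map between manifolds with the same model, as an endomorphism of the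
model vector space. -/
def derivAt (I : ModelWithCorners ℝ E H) (φ : M → N) (x : M) : E →ₗ[ℝ] E :=
  (mfderiv I I φ x : E →L[ℝ] E).toLinearMap

/-- The map `φ` is an orientation preserving local diffeomorphism at `x`. -/
structure OrientedAt (I : ModelWithCorners ℝ E H) (o : M → Orientation ℝ E (Fin n))
    (o' : N → Orientation ℝ E (Fin n)) (φ : M → N) (x : M) : Prop where
  diffeo : IsLocalDiffeomorphAt I I ∞ φ x
  pulls : Pulls (derivAt I φ x) (o' (φ x)) (o x)

/-- The differential of a chart, as an endomorphism of the model vector space. -/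
def chartEnd (I : ModelWithCorners ℝ E H) (x₀ x : M) : E →ₗ[ℝ] E := chartDeriv I x₀ x

/-- The choice `o` of orientations of tangent spaces is continuous at `x₀`. -/
def ContOrientAt (I : ModelWithCorners ℝ E H) (o : M → Orientation ℝ E (Fin n)) (x₀ : M) : Prop :=
  ∃ η : E [⋀^Fin n]→ₗ[ℝ] ℝ, ∀ᶠ x in 𝓝 x₀,
    ∃ h : η.compLinearMap (chartEnd I x₀ x) ≠ 0, o x = rayOfNeZero ℝ _ h

theorem derivAt_comp {φ : M → N} {ψ : N → P} {x : M} (hφ : IsLocalDiffeomorphAt I I ∞ φ x)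
    (hψ : IsLocalDiffeomorphAt I I ∞ ψ (φ x)) :
    derivAt I (ψ ∘ φ) x = derivAt I ψ (φ x) ∘ₗ derivAt I φ x := by
  rw [derivAt, mfderiv_comp x (hψ.mdifferentiableAt (by simp)) (hφ.mdifferentiableAt (by simp))]
  rfl

theorem exists_inverse_derivAt {φ : M → N} {x : M} (hφ : IsLocalDiffeomorphAt I I ∞ φ x) :
    ∃ D : E →ₗ[ℝ] E, derivAt I φ x ∘ₗ D = LinearMap.id ∧ D ∘ₗ derivAt I φ x = LinearMap.id :=
  hφ.exists_rightInverse_mfderiv (by simp)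

variable {o : M → Orientation ℝ E (Fin n)} {o' : N → Orientation ℝ E (Fin n)}
  {o'' : P → Orientation ℝ E (Fin n)} {φ : M → N} {ψ : N → P} {x : M}

theorem OrientedAt.comp (hψ : OrientedAt I o' o'' ψ (φ x)) (hφ : OrientedAt I o o' φ x) :
    OrientedAt I o o'' (ψ ∘ φ) x where
  diffeo := hφ.diffeo.trans hψ.diffeo
  pulls := by
    rw [derivAt_comp hφ.diffeo hψ.diffeo]
    exact hψ.pulls.comp hφ.pulls

theorem OrientedAt.congr {φ' : M → N} (hφ : OrientedAt I o o' φ x) (e : φ =ᶠ[𝓝 x] φ') :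
    OrientedAt I o o' φ' x where
  diffeo := hφ.diffeo.congr e
  pulls := by
    have h : derivAt I φ' x = derivAt I φ x := by
      unfold derivAt
      rw [e.mfderiv_eq]
    rw [h, ← e.eq_of_nhds]
    exact hφ.pulls

/-- Cancellation on the right: orientedness of a map out of a quotient or a disjoint union can be
tested after composing with the projection or the inclusions. -/
theorem OrientedAt.of_comp_right (hφ : OrientedAt I o o' φ x)
    (h : OrientedAt I o o'' (ψ ∘ φ) x) : OrientedAt I o' o'' ψ (φ x) := by
  have d := hφ.diffeo.of_comp_right h.diffeo
  refine ⟨d, ?_⟩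
  obtain ⟨D, h₁, h₂⟩ := exists_inverse_derivAt hφ.diffeo
  have e : derivAt I ψ (φ x) = derivAt I (ψ ∘ φ) x ∘ₗ D := by
    rw [derivAt_comp hφ.diffeo d, LinearMap.comp_assoc, h₁, LinearMap.comp_id]
  rw [e]
  exact h.pulls.comp (hφ.pulls.symm h₁)

theorem OrientedAt.of_comp_left (hψ : OrientedAt I o' o'' ψ (φ x))
    (h : OrientedAt I o o'' (ψ ∘ φ) x) (hφ : ContinuousAt φ x) : OrientedAt I o o' φ x := by
  have d := hψ.diffeo.of_comp_left h.diffeo hφ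
  refine ⟨d, ?_⟩
  obtain ⟨D, h₁, h₂⟩ := exists_inverse_derivAt hψ.diffeo
  have e : derivAt I φ x = D ∘ₗ derivAt I (ψ ∘ φ) x := by
    rw [derivAt_comp d hψ.diffeo, ← LinearMap.comp_assoc, h₂, LinearMap.id_comp]
  rw [e]
  exact (hψ.pulls.symm h₁).comp h.pulls

theorem orientedAt_id (o : M → Orientation ℝ E (Fin n)) (x : M) : OrientedAt I o o id x where
  diffeo := isLocalDiffeomorphAt_id x
  pulls := by
    have : derivAt I (id : M → M) x = LinearMap.id := by
      unfold derivAt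
      rw [mfderiv_id]
      rfl
    rw [this]
    exact pulls_id _

theorem OrientedAt.neg (h : OrientedAt I o o' φ x) :
    OrientedAt I (fun y => -o y) (fun y => -o' y) φ x :=
  ⟨h.diffeo, h.pulls.neg⟩

theorem exists_orientation_pulls {φ : M → N} (hφ : ∀ x, IsLocalDiffeomorphAt I I ∞ φ x)
    (o' : N → Orientation ℝ E (Fin n)) :
    ∃ o : M → Orientation ℝ E (Fin n), ∀ x, OrientedAt I o o' φ x := by
  have h (x : M) : ∃ a, Pulls (derivAt I φ x) (o' (φ x)) a := by
    obtain ⟨D, h₁, -⟩ := exists_inverse_derivAt (hφ x)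
    exact exists_pulls _ h₁ _
  choose o ho using h
  exact ⟨o, fun x => ⟨hφ x, ho x⟩⟩

/-- Continuity of orientations is transported along oriented local diffeomorphisms. -/
theorem ContOrientAt.map [FiniteDimensional ℝ E] [IsManifold I ∞ M] [IsManifold I ∞ N]
    (hn : Module.finrank ℝ E = n) (h : ∀ᶠ y in 𝓝 x, OrientedAt I o o' φ y)
    (hx : ContOrientAt I o x) : ContOrientAt I o' (φ x) := by
  have : IsManifold I 1 M := IsManifold.of_le (n := ∞) (by simp)
  have : IsManifold I 1 N := IsManifold.of_le (n := ∞) (by simp)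
  obtain ⟨η, hη⟩ := hx
  have h₀ := h.self_of_nhds
  -- `L` is the differential of `φ` read in the fixed charts around `x` and `φ x`; unlike `derivAt I
  -- φ`, it is known to vary continuously.
  let L : M → E →L[ℝ] E := inTangentCoordinates I I (id : M → M) φ (fun y => (mfderiv I I φ y : E →L[ℝ] E)) x
  have Lc : ContinuousAt L x := by
    have : ContMDiffAt I I 1 φ x := h₀.diffeo.contMDiffAt.of_le (by simp)
    exact (ContMDiffAt.mfderiv_const (m := 0) this (by simp)).continuousAt
  have key : ∀ᶠ y in 𝓝 x, (chartEnd I (φ x) (φ y)) ∘ₗ derivAt I φ y =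
      (L y).toLinearMap ∘ₗ (chartEnd I x y) := by
    filter_upwards [extChartAt_source_mem_nhds (I := I) x,
      h₀.diffeo.contMDiffAt.continuousAt.preimage_mem_nhds (chart_source_mem_nhds H (φ x))]
      with y hy hy'
    have e₁ : L y = _ := inTangentCoordinates_eq_mfderiv_comp (f := id) (g := φ)
      (ϕ := fun y => mfderiv I I φ y) (x₀ := x) (x := y) (by simpa using hy) hy'
    have e₂ := mfderivWithin_extChartAt_symm_comp_mfderiv_extChartAt' (I := I) hy
    ext v
    have e₃ := congrArg (fun A => mfderiv I 𝓘(ℝ, E) (extChartAt I (φ x)) (φ y)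
      (mfderiv I I φ y (A v))) e₂
    rw [LinearMap.comp_apply, LinearMap.comp_apply, ContinuousLinearMap.coe_coe, e₁]
    exact e₃.symm
  -- At the base points the chart differentials are the identity, so `L x` is the differential of
  -- `φ` itself and is invertible.
  obtain ⟨A, hA⟩ : ∃ A : E →L[ℝ] E, A ∘L L x = ContinuousLinearMap.id ℝ E := by
    obtain ⟨D, -, hD⟩ := exists_inverse_derivAt h₀.diffeo
    have e₁ : chartEnd I x x = LinearMap.id := by
      have := mfderiv_extChartAt_self (I := I) (x := x)
      ext v
      exact congrArg (fun A => A v) this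
    have e₂ : chartEnd I (φ x) (φ x) = LinearMap.id := by
      have := mfderiv_extChartAt_self (I := I) (x := φ x)
      ext v
      exact congrArg (fun A => A v) this
    have e₃ := key.self_of_nhds
    rw [e₁, e₂, LinearMap.id_comp, LinearMap.comp_id] at e₃
    refine ⟨LinearMap.toContinuousLinearMap D, ?_⟩
    ext v
    rw [e₃] at hD
    exact congrArg (fun A => A v) hD
  have hdet : ∀ᶠ y in 𝓝 x, 0 < LinearMap.det (A ∘L L y).toLinearMap := by
    have c : ContinuousAt (fun y => (A ∘L L y).det) x :=
      ContinuousLinearMap.continuous_det.continuousAt.comp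
        (continuousAt_const.clm_comp Lc)
    refine c.eventually_const_lt ?_
    change 0 < (A ∘L L x).det
    rw [hA]
    simp [ContinuousLinearMap.det]
  -- The constant form near `φ x`. Its pull-back through `φ` is the form of `o` near `x` times `det
  -- (A ∘ L y)`, which equals `1` at `x` and so stays positive nearby.
  refine ⟨η.compLinearMap A.toLinearMap, ?_⟩
  rw [← h₀.diffeo.map_nhds, eventually_map]
  filter_upwards [hη, key, hdet, h] with y h₁ h₂ h₃ h₄
  obtain ⟨hne, hy⟩ := h₁
  set η' : E [⋀^Fin n]→ₗ[ℝ] ℝ := (η.compLinearMap A.toLinearMap).compLinearMap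
    (chartEnd I (φ x) (φ y)) with hη'
  have e : η'.compLinearMap (derivAt I φ y) = LinearMap.det (A ∘L L y).toLinearMap •
      η.compLinearMap (chartEnd I x y) := by
    rw [hη', AlternatingMap.compLinearMap_assoc, h₂, ← AlternatingMap.compLinearMap_assoc,
      AlternatingMap.compLinearMap_assoc η]
    have := compLinearMap_eq_det_smul hn η (A ∘L L y).toLinearMap
    exact congrArg (fun ξ => ξ.compLinearMap (chartEnd I x y)) this
  have ne₁ : η'.compLinearMap (derivAt I φ y) ≠ 0 := by
    rw [e]; exact smul_ne_zero h₃.ne' hne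
  have ne₂ : η' ≠ 0 := by
    intro h0
    rw [h0] at ne₁
    exact ne₁ rfl
  refine ⟨ne₂, ?_⟩
  obtain ⟨D, hD, -⟩ := exists_inverse_derivAt h₄.diffeo
  refine h₄.pulls.unique_left (pulls_of_exists η' ne₂ ne₁ rfl ?_) hD
  rw [hy]
  exact (ray_eq_of_pos_smul _ _ h₃ e).symm

/-- The local inverse of `φ` is again oriented, so `ContOrientAt.map` applies to it. -/
theorem ContOrientAt.comap [FiniteDimensional ℝ E] [IsManifold I ∞ M] [IsManifold I ∞ N]
    (hn : Module.finrank ℝ E = n) (h : ∀ᶠ y in 𝓝 x, OrientedAt I o o' φ y)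
    (hx : ContOrientAt I o' (φ x)) : ContOrientAt I o x := by
  have h₀ := h.self_of_nhds.diffeo
  have e := h₀.localInverse_left_inv h₀.localInverse_mem_target
  rw [← e]
  refine ContOrientAt.map hn ?_ hx
  rw [← h₀.map_nhds, eventually_map]
  have h₁ : ∀ᶠ y in 𝓝 x, h₀.localInverse ∘ φ =ᶠ[𝓝 y] id :=
    h₀.localInverse_eventuallyEq_left.eventuallyEq_nhds
  filter_upwards [h, h₁] with y h₂ h₃
  exact h₂.of_comp_right ((orientedAt_id o y).congr h₃.symm)

theorem ContOrientAt.neg (h : ContOrientAt I o x) : ContOrientAt I (fun y => -o y) x := by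
  obtain ⟨η, hη⟩ := h
  refine ⟨-η, hη.mono ?_⟩
  rintro y ⟨hne, e⟩
  have key : (-η).compLinearMap (chartEnd I x y) =
      -(η.compLinearMap (chartEnd I x y)) := by
    ext v; simp
  refine ⟨by rw [key]; exact neg_ne_zero.mpr hne, ?_⟩
  change -o y = _
  rw [e, neg_rayOfNeZero]
  simp only [key]

/-- Two continuous orientations agree near a point or are opposite near that point. -/
theorem ContOrientAt.eventually_eq_or [FiniteDimensional ℝ E] (hn : Module.finrank ℝ E = n)
    {o₁ o₂ : M → Orientation ℝ E (Fin n)}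
    (h₁ : ContOrientAt I o₁ x) (h₂ : ContOrientAt I o₂ x) :
    (∀ᶠ y in 𝓝 x, o₁ y = o₂ y) ∨ ∀ᶠ y in 𝓝 x, o₁ y ≠ o₂ y := by
  obtain ⟨η, hη⟩ := h₁
  obtain ⟨ξ, hξ⟩ := h₂
  have hξ0 : ξ ≠ 0 := by
    rintro rfl
    obtain ⟨hne, -⟩ := hξ.self_of_nhds
    exact hne rfl
  -- Both forms are constant in the same chart, so the sign of one scalar settles the alternative on
  -- a whole neighbourhood.
  obtain ⟨c, rfl⟩ := exists_eq_smul_of_topForm hn η ξ hξ0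
  by_cases hc : 0 < c
  · left
    filter_upwards [hη, hξ] with y ⟨hne, e⟩ ⟨hne', e'⟩
    rw [e, e']
    exact ray_eq_of_pos_smul _ _ hc rfl
  · right
    filter_upwards [hη, hξ] with y ⟨hne, e⟩ ⟨hne', e'⟩ he
    rw [e, e'] at he
    obtain ⟨d, hd, h⟩ := exists_pos_smul_of_ray_eq he
    have : c = d := smul_left_injective ℝ hne' h
    exact hc (this ▸ hd)

/-- Two continuous orientations that agree at a point agree on every connected set around it. -/
theorem eq_of_contOrientAt_of_isPreconnected [FiniteDimensional ℝ E]
    (hn : Module.finrank ℝ E = n) {o₁ o₂ : M → Orientation ℝ E (Fin n)}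
    (h₁ : ∀ x, ContOrientAt I o₁ x) (h₂ : ∀ x, ContOrientAt I o₂ x) {s : Set M}
    (hs : IsPreconnected s) {x y : M} (hx : x ∈ s) (hy : y ∈ s) (e : o₁ x = o₂ x) :
    o₁ y = o₂ y := by
  have hclopen : IsClopen {z | o₁ z = o₂ z} := by
    constructor
    · rw [← isOpen_compl_iff, isOpen_iff_mem_nhds]
      intro z hz
      rcases (h₁ z).eventually_eq_or hn (h₂ z) with h | h
      · exact absurd h.self_of_nhds hz
      · exact h
    · rw [isOpen_iff_mem_nhds]
      intro z hz
      rcases (h₁ z).eventually_eq_or hn (h₂ z) with h | h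
      · exact h
      · exact absurd hz h.self_of_nhds
  exact hs.subset_isClopen hclopen ⟨x, hx, e⟩ hy

end Oriented

/-! ### Quotients of oriented manifolds by étale equivalence relations -/

section Etale

open Set Filter

variable {n : ℕ} {E H : Type*} [NormedAddCommGroup E] [NormedSpace ℝ E] [TopologicalSpace H]
  {I : ModelWithCorners ℝ E H} {V Q : Type*} [TopologicalSpace V] [ChartedSpace H V]

/-- The fibres of `q` are locally permuted by orientation preserving local diffeomorphisms. -/
def IsEtale (I : ModelWithCorners ℝ E H) (o : V → Orientation ℝ E (Fin n)) (q : V → Q) : Prop :=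
  ∀ x y, q x = q y → ∃ φ : V → V, φ x = y ∧ ∀ᶠ z in 𝓝 x, OrientedAt I o o φ z ∧ q (φ z) = q z

variable [TopologicalSpace Q] {o : V → Orientation ℝ E (Fin n)} {q : V → Q}

/-- Near `x`, the composite of `q` with a local section coincides with the fibre-preserving
diffeomorphism that carries `x` to the point chosen by the section. These composites are the
transition maps of the quotient. -/
theorem IsEtale.localSection_comp (h : IsEtale I o q) (hq : IsLocalHomeomorph q) {w x : V}
    (hx : q x ∈ (hq.localInverseAt w).source) :
    OrientedAt I o o (hq.localInverseAt w ∘ q) x := by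
  set s := hq.localInverseAt w
  obtain ⟨φ, hφ, hφ'⟩ := h x (s (q x)) (hq.apply_localInverseAt_of_mem hx).symm
  refine hφ'.self_of_nhds.1.congr ?_
  have hc : ContinuousAt φ x := hφ'.self_of_nhds.1.diffeo.contMDiffAt.continuousAt
  have hmem : ∀ᶠ z in 𝓝 x, φ z ∈ s.target := by
    refine hc.eventually (s.open_target.mem_nhds ?_)
    rw [hφ]
    exact s.map_source hx
  filter_upwards [hφ', hmem] with z h₁ h₂
  have := s.right_inv h₂
  rw [hq.localInverseAt_symm, h₁.2] at this
  exact this.symm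

/-- The charts of `Q` are local sections of `q` followed by charts of `V`, so a coordinate change is
`χ' ∘ (s' ∘ q) ∘ χ⁻¹` with smooth middle factor. -/
theorem IsEtale.isManifold [IsManifold I ∞ V] (h : IsEtale I o q) (hq : IsLocalHomeomorph q)
    {g : Q → V} (hg : Function.RightInverse g q) :
    letI : ChartedSpace H Q := hq.chartedSpaceOfRightInverse hg
    IsManifold I ∞ Q := by
  let : ChartedSpace H Q := hq.chartedSpaceOfRightInverse hg
  refine isManifold_of_contDiffOn I ∞ Q ?_
  rintro _ _ ⟨a, rfl⟩ ⟨b, rfl⟩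
  rintro _ ⟨hu, ⟨u, rfl⟩⟩
  simp only [mem_preimage, I.left_inv] at hu
  set s := hq.localInverseAt (g a)
  set s' := hq.localInverseAt (g b)
  set χ := chartAt H (g a)
  set χ' := chartAt H (g b)
  have hsq : ⇑s.symm = q := hq.localInverseAt_symm _
  have hu₁ : u ∈ χ.target := by
    simp only [mfld_simps] at hu
    exact hu.1.1
  have hu₂ : q (χ.symm u) ∈ s'.source := by
    simp only [mfld_simps] at hu
    rw [← hsq]
    exact hu.2.1
  have hu₃ : s' (q (χ.symm u)) ∈ χ'.source := by
    simp only [mfld_simps] at hu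
    rw [← hsq]
    exact hu.2.2
  have c₁ : ContMDiffWithinAt 𝓘(ℝ, E) I ∞ (χ.extend I).symm (I '' χ.target) (I u) :=
    contMDiffOn_extend_symm (IsManifold.chart_mem_maximalAtlas (g a)) _ ⟨u, hu₁, rfl⟩
  have e₁ : (χ.extend I).symm (I u) = χ.symm u := by simp
  have c₂ : ContMDiffAt I I ∞ (s' ∘ q) ((χ.extend I).symm (I u)) := by
    rw [e₁]
    exact (h.localSection_comp hq hu₂).diffeo.contMDiffAt
  have c₃ : ContMDiffAt I 𝓘(ℝ, E) ∞ (χ'.extend I) ((s' ∘ q) ((χ.extend I).symm (I u))) := by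
    refine χ'.contMDiffAt_extend (IsManifold.chart_mem_maximalAtlas (g b)) ?_
    rw [e₁]
    exact hu₃
  have c := (c₃.comp _ c₂).comp_contMDiffWithinAt _ c₁
  rw [contMDiffWithinAt_iff_contDiffWithinAt] at c
  refine (c.mono ?_).congr_of_eventuallyEq ?_ ?_
  · rintro _ ⟨hv, ⟨v, rfl⟩⟩
    simp only [mem_preimage, I.left_inv] at hv
    simp only [mfld_simps] at hv
    exact ⟨v, hv.1.1, rfl⟩
  · refine Eventually.of_forall fun v => ?_
    simp [← hsq]
  · simp [← hsq]

/-- The base of a surjective étale local homeomorphism from an oriented manifold is an oriented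
manifold. -/
theorem IsEtale.exists_orientation [FiniteDimensional ℝ E] [IsManifold I ∞ V]
    (hn : Module.finrank ℝ E = n) (h : IsEtale I o q)
    (hq : IsLocalHomeomorph q) (hs : Function.Surjective q) (ho : ∀ x, ContOrientAt I o x) :
    ∃ (_ : ChartedSpace H Q) (_ : IsManifold I ∞ Q) (oQ : Q → Orientation ℝ E (Fin n)),
      (∀ z, ContOrientAt I oQ z) ∧ ∀ x, OrientedAt I o oQ q x := by
  obtain ⟨g, hg⟩ := hs.hasRightInverse
  let : ChartedSpace H Q := hq.chartedSpaceOfRightInverse hg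
  have hQ : IsManifold I ∞ Q := h.isManifold hq hg
  have hchart (z : Q) : chartAt H z = (hq.localInverseAt (g z)).trans (chartAt H (g z)) := rfl
  have hsource (z : Q) : z ∈ (hq.localInverseAt (g z)).source := by
    have := hq.apply_self_mem_localInverseAt_source (x := g z)
    rwa [hg z] at this
  have hs₀ (z : Q) : hq.localInverseAt (g z) z = g z := by
    have := hq.localInverseAt_apply_self (x := g z)
    rwa [hg z] at this
  have smooth (x : V) : ContMDiffAt I I ∞ q x := by
    rw [contMDiffAt_iff_target]
    refine ⟨hq.continuous.continuousAt, ?_⟩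
    have c₁ : ContMDiffAt I I ∞ (hq.localInverseAt (g (q x)) ∘ q) x :=
      (h.localSection_comp hq (hsource _)).diffeo.contMDiffAt
    have c₂ : ContMDiffAt I 𝓘(ℝ, E) ∞ (extChartAt I (g (q x)))
        ((hq.localInverseAt (g (q x)) ∘ q) x) := by
      refine contMDiffAt_extChartAt' ?_
      rw [Function.comp_apply, hs₀]
      exact mem_chart_source _ _
    exact c₂.comp x c₁
  -- At the chosen lift `g z`, the chart of `Q` is by construction the local section followed by the
  -- chart of `V`, so the section is a smooth inverse of `q`.
  have diff₀ (z : Q) : IsLocalDiffeomorphAt I I ∞ q (g z) := by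
    refine isLocalDiffeomorphAt_of_eventually (g := hq.localInverseAt (g z)) ?_ ?_
    · filter_upwards [(hq.localInverseAt (g z)).open_target.mem_nhds
        hq.self_mem_localInverseAt_target] with x hx
      refine ⟨smooth x, ?_⟩
      have := (hq.localInverseAt (g z)).right_inv hx
      rwa [hq.localInverseAt_symm] at this
    · rw [hg z]
      filter_upwards [(chartAt H z).open_source.mem_nhds (mem_chart_source H z)] with y hy
      have hy₁ : y ∈ (hq.localInverseAt (g z)).source := by
        rw [hchart] at hy
        simp only [mfld_simps] at hy
        exact hy.1
      refine ⟨?_, hq.apply_localInverseAt_of_mem hy₁⟩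
      have c₁ : ContMDiffAt I I ∞ (chartAt H z) y :=
        (contMDiffOn_chart (I := I) (n := ∞) (x := z)).contMDiffAt
          ((chartAt H z).open_source.mem_nhds hy)
      have hy₂ : chartAt H z y ∈ (chartAt H (g z)).target := by
        have := (chartAt H z).map_source hy
        rw [hchart] at this ⊢
        simp only [mfld_simps] at this
        exact this.1
      have c₂ : ContMDiffAt I I ∞ (chartAt H (g z)).symm (chartAt H z y) :=
        (contMDiffOn_chart_symm (I := I) (n := ∞) (x := g z)).contMDiffAt
          ((chartAt H (g z)).open_target.mem_nhds hy₂)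
      refine (c₂.comp y c₁).congr_of_eventuallyEq ?_
      filter_upwards [(chartAt H z).open_source.mem_nhds hy] with y' hy'
      rw [hchart] at hy' ⊢
      simp only [mfld_simps] at hy'
      exact ((chartAt H (g z)).left_inv hy'.2).symm
  have hor (z : Q) : ∃ a : Orientation ℝ E (Fin n), Pulls (derivAt I q (g z)) a (o (g z)) := by
    obtain ⟨D, h₁, h₂⟩ := exists_inverse_derivAt (diff₀ z)
    obtain ⟨a, ha⟩ := exists_pulls D h₂ (o (g z))
    exact ⟨a, ha.symm h₂⟩
  choose oQ hoQ using hor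
  have hO₀ (z : Q) : OrientedAt I o oQ q (g z) := ⟨diff₀ z, by rw [hg z]; exact hoQ z⟩
  -- The orientation of `Q` was read off at the chosen lifts; the fibre diffeomorphisms, which
  -- preserve `o`, carry the property to every other point.
  have hO (x : V) : OrientedAt I o oQ q x := by
    obtain ⟨φ, hφ, hφ'⟩ := h x (g (q x)) (hg _).symm
    have h₁ : OrientedAt I o oQ q (φ x) := by rw [hφ]; exact hO₀ _
    refine (h₁.comp hφ'.self_of_nhds.1).congr ?_
    filter_upwards [hφ'] with z hz
    exact hz.2
  refine ⟨_, hQ, oQ, fun z => ?_, hO⟩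
  have := (ho (g z)).map hn (Eventually.of_forall hO)
  rwa [hg z] at this

/-- The quotient of an oriented Hausdorff manifold by a closed partial involution without fixed
points which is locally given by orientation preserving local diffeomorphisms is an oriented
Hausdorff manifold. -/
theorem exists_oriented_quotient {V : Type} [TopologicalSpace V] [ChartedSpace H V]
    [FiniteDimensional ℝ E] [IsManifold I ∞ V] [T2Space V]
    (hn : Module.finrank ℝ E = n) {o : V → Orientation ℝ E (Fin n)}
    (ho : ∀ x, ContOrientAt I o x) (R : V → V → Prop)
    (hclosed : IsClosed {z : V × V | R z.1 z.2}) (hirr : ∀ x, ¬ R x x)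
    (hsymm : ∀ x y, R x y → R y x) (htrans : ∀ x y z, R x y → R y z → x = z)
    (hetale : ∀ x y, R x y → ∃ (P : Type) (_ : TopologicalSpace P) (_ : ChartedSpace H P)
      (oP : P → Orientation ℝ E (Fin n)) (w : P) (α β : P → V), α w = x ∧ β w = y ∧
      ∀ᶠ z in 𝓝 w, OrientedAt I oP o α z ∧ OrientedAt I oP o β z ∧ R (α z) (β z)) :
    ∃ (Q : Type) (_ : TopologicalSpace Q) (_ : ChartedSpace H Q) (_ : IsManifold I ∞ Q)
      (_ : T2Space Q) (oQ : Q → Orientation ℝ E (Fin n)) (q : V → Q),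
      Function.Surjective q ∧ (∀ z, ContOrientAt I oQ z) ∧ (∀ x, OrientedAt I o oQ q x) ∧
      ∀ x y, q x = q y ↔ x = y ∨ R x y := by
  let S : Setoid V :=
    { r := fun x y => x = y ∨ R x y
      iseqv := by
        refine ⟨fun x => Or.inl rfl, ?_, ?_⟩
        · rintro x y (rfl | h)
          · exact Or.inl rfl
          · exact Or.inr (hsymm _ _ h)
        · rintro x y z (rfl | h) (rfl | h')
          · exact Or.inl rfl
          · exact Or.inr h'
          · exact Or.inr h
          · exact Or.inl (htrans _ _ _ h h') }
  let q : V → Quotient S := Quotient.mk S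
  have hqq (x y : V) : q x = q y ↔ x = y ∨ R x y := Quotient.eq (r := S)
  have het : IsEtale I o q := by
    intro x y hxy
    rcases (hqq x y).1 hxy with rfl | hR
    · exact ⟨id, rfl, Eventually.of_forall fun z => ⟨orientedAt_id o z, rfl⟩⟩
    obtain ⟨P, _, _, oP, w, α, β, rfl, rfl, hw⟩ := hetale x y hR
    have hα := hw.self_of_nhds.1.diffeo
    have e := hα.localInverse_left_inv hα.localInverse_mem_target
    -- The two maps out of `P` parametrize pairs of related points, so `β ∘ α⁻¹` moves each point to
    -- its partner.
    refine ⟨β ∘ hα.localInverse, congrArg β e, ?_⟩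
    rw [← hα.map_nhds, eventually_map]
    have h₁ : ∀ᶠ y in 𝓝 w, hα.localInverse ∘ α =ᶠ[𝓝 y] id :=
      hα.localInverse_eventuallyEq_left.eventuallyEq_nhds
    filter_upwards [hw, h₁] with z hz h₂
    have e₂ : hα.localInverse (α z) = z := h₂.eq_of_nhds
    refine ⟨OrientedAt.of_comp_right (φ := α) hz.1 (hz.2.1.congr ?_), ?_⟩
    · filter_upwards [h₂] with z' hz'
      exact congrArg β hz'.symm
    · rw [Function.comp_apply, e₂]
      exact (hqq _ _).2 (Or.inr (hsymm _ _ hz.2.2))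
  have hcont : Continuous q := continuous_quot_mk
  have hopen : IsOpenMap q := by
    intro U hU
    refine (isQuotientMap_quotient_mk' (s := S)).isOpen_preimage.1 ?_
    rw [isOpen_iff_mem_nhds]
    rintro y ⟨u, hu, huy⟩
    obtain ⟨φ, rfl, hφ'⟩ := het y u huy.symm
    have hc : ContinuousAt φ y := hφ'.self_of_nhds.1.diffeo.contMDiffAt.continuousAt
    filter_upwards [hφ', hc.preimage_mem_nhds (hU.mem_nhds hu)] with z h₁ h₂
    exact ⟨φ z, h₂, h₁.2⟩
  have hloc : IsLocalHomeomorph q := by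
    refine IsLocalHomeomorph.mk q fun x => ?_
    -- Closedness and irreflexivity give a neighbourhood of `x` containing no two related points, on
    -- which `q` is injective.
    have : {z : V × V | R z.1 z.2}ᶜ ∈ 𝓝 (x, x) := hclosed.isOpen_compl.mem_nhds (hirr x)
    rw [nhds_prod_eq, mem_prod_same_iff] at this
    obtain ⟨U, hU, hUR⟩ := this
    obtain ⟨U', hU', hU'o, hxU'⟩ := mem_nhds_iff.1 hU
    have hinj : InjOn q U' := by
      intro a ha b hb hab
      refine ((hqq a b).1 hab).resolve_right fun hR => ?_
      exact hUR (show (a, b) ∈ U ×ˢ U from ⟨hU' ha, hU' hb⟩) hR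
    have : Nonempty V := ⟨x⟩
    refine ⟨OpenPartialHomeomorph.ofContinuousOpen (hinj.bijOn_image.toPartialEquiv q U' _)
      hcont.continuousOn hopen hU'o, hxU', fun y _ => rfl⟩
  have hsurj : Function.Surjective q := Quotient.mk_surjective
  obtain ⟨_, hQ, oQ, h₁, h₂⟩ := het.exists_orientation hn hloc hsurj ho
  -- As `q` is open, it suffices that the graph of the equivalence relation, the diagonal together
  -- with `R`, is closed.
  have hT2 : T2Space (Quotient S) := by
    rw [t2Space_iff_of_isOpenQuotientMap (π := q) ⟨hsurj, hcont, hopen⟩]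
    have : {z : V × V | q z.1 = q z.2} = {z : V × V | z.1 = z.2} ∪ {z : V × V | R z.1 z.2} := by
      ext z
      exact hqq _ _
    rw [this]
    exact (isClosed_eq continuous_fst continuous_snd).union hclosed
  exact ⟨Quotient S, inferInstance, _, hQ, hT2, oQ, q, hsurj, h₁, h₂, hqq⟩

end Etale

/-! ### The half-line -/

section HalfLine

open Set Filter

/-- The coordinate of a point of the half-line. -/
def halfCoord (t : EuclideanHalfSpace 1) : ℝ := t.1 0

/-- The point of the half-line with coordinate `max r 0`. -/
def mkHalf (r : ℝ) : EuclideanHalfSpace 1 := ⟨WithLp.toLp 2 fun _ => max r 0, le_max_right _ _⟩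

theorem continuous_halfCoord : Continuous halfCoord := by
  unfold halfCoord
  fun_prop

theorem continuous_mkHalf : Continuous mkHalf := by
  refine Continuous.subtype_mk ?_ _
  fun_prop

theorem halfCoord_nonneg (t : EuclideanHalfSpace 1) : 0 ≤ halfCoord t := t.2

@[simp]
theorem halfCoord_mkHalf (r : ℝ) : halfCoord (mkHalf r) = max r 0 := rfl

@[simp]
theorem halfCoord_zero : halfCoord 0 = 0 := rfl

theorem halfCoord_injective : Function.Injective halfCoord := by
  intro s t h
  refine EuclideanHalfSpace.ext _ _ ?_
  ext i
  rw [Subsingleton.elim i 0]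
  exact h

theorem mkHalf_halfCoord (t : EuclideanHalfSpace 1) : mkHalf (halfCoord t) = t :=
  halfCoord_injective (by simp [halfCoord_nonneg])

theorem mkHalf_zero : mkHalf 0 = 0 := halfCoord_injective (by simp)

theorem tendsto_halfCoord (t : EuclideanHalfSpace 1) :
    Tendsto halfCoord (𝓝 t) (𝓝[Ici 0] (halfCoord t)) :=
  tendsto_nhdsWithin_iff.2 ⟨continuous_halfCoord.continuousAt, Eventually.of_forall halfCoord_nonneg⟩

/-- The self-map of the half-line given by a real function. -/
def halfMap (φ : ℝ → ℝ) (t : EuclideanHalfSpace 1) : EuclideanHalfSpace 1 :=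
  mkHalf (φ (halfCoord t))

/-- Where `φ` is nonnegative the truncation in `mkHalf` does nothing, so in coordinates `halfMap φ`
is `φ` itself on the half-space. -/
theorem halfMap_eventuallyEq {φ : ℝ → ℝ} {t : EuclideanHalfSpace 1}
    (h : ∀ᶠ s in 𝓝[Ici 0] (halfCoord t), 0 ≤ φ s) :
    (𝓡∂ 1) ∘ halfMap φ ∘ (𝓡∂ 1).symm =ᶠ[𝓝[range (𝓡∂ 1)] ((𝓡∂ 1) t)]
      fun y => φ (y 0) • EuclideanSpace.single (0 : Fin 1) (1 : ℝ) := by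
  have ht : Tendsto (fun y : EuclideanSpace ℝ (Fin 1) => y 0) (𝓝[range (𝓡∂ 1)] ((𝓡∂ 1) t))
      (𝓝[Ici 0] (halfCoord t)) := by
    refine tendsto_nhdsWithin_iff.2 ⟨?_, ?_⟩
    · have : Continuous fun y : EuclideanSpace ℝ (Fin 1) => y 0 := by fun_prop
      exact (this.tendsto _).mono_left nhdsWithin_le_nhds
    · filter_upwards [self_mem_nhdsWithin] with y hy
      rwa [range_modelWithCornersEuclideanHalfSpace] at hy
  filter_upwards [ht.eventually h, self_mem_nhdsWithin] with y hy hy'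
  obtain ⟨s, rfl⟩ := hy'
  ext i
  rw [Subsingleton.elim i 0]
  simp only [Function.comp_apply, ModelWithCorners.left_inv]
  change max (φ (halfCoord s)) 0 = _
  rw [max_eq_left (show 0 ≤ φ (halfCoord s) from hy)]
  simp [halfCoord]

theorem continuousAt_halfMap {φ : ℝ → ℝ} {t : EuclideanHalfSpace 1}
    (h : ContinuousAt φ (halfCoord t)) : ContinuousAt (halfMap φ) t :=
  continuous_mkHalf.continuousAt.comp
    (ContinuousAt.comp (f := halfCoord) h continuous_halfCoord.continuousAt)

theorem contMDiffAt_halfMap {φ : ℝ → ℝ} {t : EuclideanHalfSpace 1}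
    (hφ : ContDiffAt ℝ ∞ φ (halfCoord t)) (h : ∀ᶠ s in 𝓝[Ici 0] (halfCoord t), 0 ≤ φ s) :
    ContMDiffAt (𝓡∂ 1) (𝓡∂ 1) ∞ (halfMap φ) t := by
  rw [contMDiffAt_iff]
  refine ⟨continuousAt_halfMap hφ.continuousAt, ?_⟩
  simp only [mfld_simps]
  have e := halfMap_eventuallyEq h
  refine ContDiffWithinAt.congr_of_eventuallyEq ?_ e (e.eq_of_nhdsWithin (mem_range_self t))
  refine ContDiffAt.contDiffWithinAt ?_
  have h₁ : ContDiffAt ℝ ∞ (fun y : EuclideanSpace ℝ (Fin 1) => y 0) ((𝓡∂ 1) t) := by fun_prop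
  have h₂ : ContDiffAt ℝ ∞ (fun y : EuclideanSpace ℝ (Fin 1) => φ (y 0)) ((𝓡∂ 1) t) :=
    ContDiffAt.comp ((𝓡∂ 1) t) hφ h₁
  exact h₂.smul contDiffAt_const

/-- The map `θ` is a local diffeomorphism of the half-line at `t`, with derivative `a`. -/
structure HalfDiffeoAt (θ : EuclideanHalfSpace 1 → EuclideanHalfSpace 1) (a : ℝ)
    (t : EuclideanHalfSpace 1) : Prop where
  diffeo : IsLocalDiffeomorphAt (𝓡∂ 1) (𝓡∂ 1) ∞ θ t
  deriv : HasMFDerivAt (𝓡∂ 1) (𝓡∂ 1) θ t (a • ContinuousLinearMap.id ℝ (EuclideanSpace ℝ (Fin 1)))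

theorem hasMFDerivAt_halfMap {φ : ℝ → ℝ} {a : ℝ} {t : EuclideanHalfSpace 1}
    (hφ : HasDerivAt φ a (halfCoord t)) (h : ∀ᶠ s in 𝓝[Ici 0] (halfCoord t), 0 ≤ φ s) :
    HasMFDerivAt (𝓡∂ 1) (𝓡∂ 1) (halfMap φ) t
      (a • ContinuousLinearMap.id ℝ (EuclideanSpace ℝ (Fin 1))) := by
  refine ⟨continuousAt_halfMap hφ.continuousAt, ?_⟩
  have e := halfMap_eventuallyEq h
  let π : EuclideanSpace ℝ (Fin 1) →L[ℝ] ℝ := EuclideanSpace.proj 0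
  have h₁ : HasFDerivAt (fun y : EuclideanSpace ℝ (Fin 1) => y 0) π ((𝓡∂ 1) t) :=
    π.hasFDerivAt
  have h₂ := (HasDerivAt.comp_hasFDerivAt ((𝓡∂ 1) t) hφ h₁).smul_const
    (EuclideanSpace.single (0 : Fin 1) (1 : ℝ))
  have h₃ : (a • π).smulRight
      (EuclideanSpace.single (0 : Fin 1) (1 : ℝ)) =
      a • ContinuousLinearMap.id ℝ (EuclideanSpace ℝ (Fin 1)) := by
    ext v i
    rw [Subsingleton.elim i 0]
    simp [π]
  rw [h₃] at h₂
  have h₄ := h₂.hasFDerivWithinAt (s := range (𝓡∂ 1))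
  exact h₄.congr_of_eventuallyEq e (e.eq_of_nhdsWithin (mem_range_self t))

theorem halfDiffeoAt_halfMap {φ ψ : ℝ → ℝ} {a : ℝ} {t : EuclideanHalfSpace 1}
    (ha : HasDerivAt φ a (halfCoord t))
    (hφ : ∀ᶠ s in 𝓝[Ici 0] (halfCoord t), ContDiffAt ℝ ∞ φ s ∧ 0 ≤ φ s ∧ ψ (φ s) = s)
    (hψ : ∀ᶠ s in 𝓝[Ici 0] (φ (halfCoord t)), ContDiffAt ℝ ∞ ψ s ∧ 0 ≤ ψ s ∧ φ (ψ s) = s) :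
    HalfDiffeoAt (halfMap φ) a t where
  diffeo := by
    have h₀ : halfCoord (halfMap φ t) = φ (halfCoord t) :=
      max_eq_left (hφ.self_of_nhdsWithin (halfCoord_nonneg t)).2.1
    rw [← h₀] at hψ
    refine isLocalDiffeomorphAt_of_eventually (g := halfMap ψ) ?_ ?_
    · filter_upwards [(tendsto_halfCoord t).eventually (eventually_eventually_nhdsWithin.2 hφ)]
        with s hs
      have h₁ := hs.self_of_nhdsWithin (halfCoord_nonneg s)
      refine ⟨contMDiffAt_halfMap h₁.1 (hs.mono fun _ h => h.2.1), halfCoord_injective ?_⟩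
      simp [halfMap, h₁.2.1, h₁.2.2, halfCoord_nonneg]
    · filter_upwards [(tendsto_halfCoord _).eventually (eventually_eventually_nhdsWithin.2 hψ)]
        with s hs
      have h₁ := hs.self_of_nhdsWithin (halfCoord_nonneg s)
      refine ⟨contMDiffAt_halfMap h₁.1 (hs.mono fun _ h => h.2.1), halfCoord_injective ?_⟩
      simp [halfMap, h₁.2.1, h₁.2.2, halfCoord_nonneg]
  deriv := hasMFDerivAt_halfMap ha (hφ.mono fun _ h => h.2.1)

theorem halfDiffeoAt_id (t : EuclideanHalfSpace 1) : HalfDiffeoAt id 1 t where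
  diffeo := isLocalDiffeomorphAt_id t
  deriv := by
    rw [one_smul]
    exact hasMFDerivAt_id t

/-- The map `s / (1 + s)` fixes `0` and carries `[0, ∞)` onto `[0, 1)`; it shortens the collar of
the cylinder so that it embeds in the quotient. -/
theorem halfDiffeoAt_shrink (t : EuclideanHalfSpace 1) :
    ∃ a, 0 < a ∧ HalfDiffeoAt (halfMap fun s => s / (1 + s)) a t := by
  have ht := halfCoord_nonneg t
  refine ⟨1 / (1 + halfCoord t) ^ 2, by positivity, halfDiffeoAt_halfMap (ψ := fun s => s / (1 - s))
    ?_ ?_ ?_⟩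
  · have h := (hasDerivAt_id (halfCoord t)).div ((hasDerivAt_id (halfCoord t)).const_add 1)
      (show 1 + id (halfCoord t) ≠ 0 by simp only [id]; positivity)
    have e : (1 * (1 + id (halfCoord t)) - id (halfCoord t) * 1) / (1 + id (halfCoord t)) ^ 2 =
        1 / (1 + halfCoord t) ^ 2 := by simp only [id]; ring
    rw [← e]
    exact h
  · filter_upwards [self_mem_nhdsWithin] with s hs
    have hs' : (0 : ℝ) ≤ s := hs
    have hne : 1 + s ≠ 0 := by positivity
    refine ⟨contDiffAt_id.div (contDiffAt_const.add contDiffAt_id) hne, by positivity, ?_⟩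
    field_simp
    ring
  · have h1 : halfCoord t / (1 + halfCoord t) < 1 := by
      rw [div_lt_one (by positivity)]
      linarith
    filter_upwards [self_mem_nhdsWithin, nhdsWithin_le_nhds (Iio_mem_nhds h1)] with s hs hs1
    have hs' : (0 : ℝ) ≤ s := hs
    have hs1' : 0 < 1 - s := sub_pos.2 hs1
    refine ⟨contDiffAt_id.div (contDiffAt_const.sub contDiffAt_id) hs1'.ne', by positivity, ?_⟩
    have : 1 + s / (1 - s) = 1 / (1 - s) := by field_simp; ring
    rw [this]
    field_simp

theorem halfDiffeoAt_inv {t : EuclideanHalfSpace 1} (ht : 0 < halfCoord t) :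
    ∃ a, a < 0 ∧ HalfDiffeoAt (halfMap fun s => s⁻¹) a t := by
  have key (r : ℝ) (hr : 0 < r) : ∀ᶠ s in 𝓝[Ici 0] r,
      ContDiffAt ℝ ∞ (fun s : ℝ => s⁻¹) s ∧ 0 ≤ s⁻¹ ∧ s⁻¹⁻¹ = s := by
    filter_upwards [nhdsWithin_le_nhds (Ioi_mem_nhds hr)] with s hs
    have hs' : 0 < s := hs
    exact ⟨contDiffAt_inv ℝ hs'.ne', by positivity, inv_inv s⟩
  refine ⟨-(halfCoord t ^ 2)⁻¹, by simp; positivity, halfDiffeoAt_halfMap (ψ := fun s => s⁻¹)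
    (hasDerivAt_inv ht.ne') (key _ ht) (key _ (by positivity))⟩

theorem halfDiffeoAt_one_sub {t : EuclideanHalfSpace 1} (h0 : 0 < halfCoord t)
    (h1 : halfCoord t < 1) :
    HalfDiffeoAt (halfMap fun s => 1 - s) (-1) t := by
  have key (r : ℝ) (hr : r < 1) : ∀ᶠ s in 𝓝[Ici 0] r,
      ContDiffAt ℝ ∞ (fun s : ℝ => 1 - s) s ∧ 0 ≤ 1 - s ∧ 1 - (1 - s) = s := by
    filter_upwards [nhdsWithin_le_nhds (Iio_mem_nhds hr)] with s hs
    have hs' : s < 1 := hs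
    exact ⟨contDiffAt_const.sub contDiffAt_id, by linarith, by ring⟩
  exact halfDiffeoAt_halfMap (ψ := fun s => 1 - s) ((hasDerivAt_id _).const_sub 1) (key _ h1)
    (key _ (by linarith))

end HalfLine

/-! ### Products with the half-line -/

section HalfProduct

open Set Filter

variable {p : ℕ} {M N : Type*} [TopologicalSpace M] [ChartedSpace (EuclideanSpace ℝ (Fin p)) M]
  [TopologicalSpace N] [ChartedSpace (EuclideanSpace ℝ (Fin p)) N]

/-- The orientation of `M × [0, ∞)` whose boundary orientation is `o`. -/
def prodOrient (o : M → Orientation ℝ (EuclideanSpace ℝ (Fin p)) (Fin p)) :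
    M × EuclideanHalfSpace 1 → Orientation ℝ (HalfSpaceVec p) (Fin (p + 1)) :=
  fun z => prodOr (o z.1)

variable {o : M → Orientation ℝ (EuclideanSpace ℝ (Fin p)) (Fin p)}
  {o' : N → Orientation ℝ (EuclideanSpace ℝ (Fin p)) (Fin p)} {φ : M → N}
  {θ : EuclideanHalfSpace 1 → EuclideanHalfSpace 1} {a : ℝ} {x : M} {t : EuclideanHalfSpace 1}

theorem derivAt_prodMap (hφ : IsLocalDiffeomorphAt (𝓡 p) (𝓡 p) ∞ φ x) (hθ : HalfDiffeoAt θ a t)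
    (v : EuclideanSpace ℝ (Fin p)) (w : EuclideanSpace ℝ (Fin 1)) :
    derivAt (halfModel p) (Prod.map φ θ) (x, t) (v, w) = (derivAt (𝓡 p) φ x v, a • w) := by
  have h₁ := (hφ.mdifferentiableAt (by simp)).hasMFDerivAt
  have h := HasMFDerivAt.prodMap (p := (x, t)) h₁ hθ.deriv
  rw [derivAt, h.mfderiv]
  exact Prod.ext rfl (congrArg (fun A => A w) hθ.deriv.mfderiv)

theorem OrientedAt.prodMap_pos (hφ : OrientedAt (𝓡 p) o o' φ x) (hθ : HalfDiffeoAt θ a t)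
    (ha : 0 < a) :
    OrientedAt (halfModel p) (prodOrient o) (prodOrient o') (Prod.map φ θ) (x, t) where
  diffeo := hφ.diffeo.prodMap hθ.diffeo
  pulls := hφ.pulls.prodOr_pos ha (derivAt_prodMap hφ.diffeo hθ)

theorem OrientedAt.prodMap_neg (hφ : OrientedAt (𝓡 p) (fun y => -o y) o' φ x)
    (hθ : HalfDiffeoAt θ a t) (ha : a < 0) :
    OrientedAt (halfModel p) (prodOrient o) (prodOrient o') (Prod.map φ θ) (x, t) where
  diffeo := hφ.diffeo.prodMap hθ.diffeo
  pulls := hφ.pulls.prodOr_neg ha (derivAt_prodMap hφ.diffeo hθ)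

/-- The factor `(1 : ℝ)` gives the formula the shape required by `Pulls.prodOr_pos`. -/
theorem chartEnd_prod [IsManifold (𝓡 p) ∞ M] {x₀ : M} {t₀ : EuclideanHalfSpace 1}
    (hx : x ∈ (chartAt (EuclideanSpace ℝ (Fin p)) x₀).source)
    (v : EuclideanSpace ℝ (Fin p)) (w : EuclideanSpace ℝ (Fin 1)) :
    chartEnd (halfModel p) (x₀, t₀) (x, t) (v, w) = (chartEnd (𝓡 p) x₀ x v, (1 : ℝ) • w) := by
  have : IsManifold (𝓡 p) 1 M := IsManifold.of_le (n := ∞) (by simp)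
  have h₁ := (mdifferentiableAt_extChartAt (I := 𝓡 p) hx).hasMFDerivAt
  have h₂ : HasMFDerivAt (𝓡∂ 1) 𝓘(ℝ, EuclideanSpace ℝ (Fin 1)) (extChartAt (𝓡∂ 1) t₀) t
      (ContinuousLinearMap.id ℝ (EuclideanSpace ℝ (Fin 1))) := by
    have h := (mdifferentiableAt_extChartAt (I := 𝓡∂ 1) (mem_chart_source _ t)).hasMFDerivAt
    rw [mfderiv_extChartAt_self] at h
    exact h
  have h₃ := (h₁.comp (x, t) (hasMFDerivAt_fst (I' := 𝓡∂ 1) (x, t))).prodMk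
    (h₂.comp (x, t) (hasMFDerivAt_snd (I := 𝓡 p) (x, t)))
  have h₄ : chartEnd (halfModel p) (x₀, t₀) (x, t) =
      (mfderiv (halfModel p) 𝓘(ℝ, HalfSpaceVec p) (extChartAt (halfModel p) (x₀, t₀)) (x, t) :
        HalfSpaceVec p →L[ℝ] HalfSpaceVec p).toLinearMap := rfl
  have h₅ : HasMFDerivAt (halfModel p) 𝓘(ℝ, HalfSpaceVec p)
      (extChartAt (halfModel p) (x₀, t₀)) (x, t)
      ((mfderiv (𝓡 p) 𝓘(ℝ, EuclideanSpace ℝ (Fin p)) (extChartAt (𝓡 p) x₀) x :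
        EuclideanSpace ℝ (Fin p) →L[ℝ] EuclideanSpace ℝ (Fin p)).prodMap
        (ContinuousLinearMap.id ℝ (EuclideanSpace ℝ (Fin 1)))) := by
    rw [extChartAt_prod, modelWithCornersSelf_prod, ← chartedSpaceSelf_prod]
    exact h₃
  rw [h₄, h₅.mfderiv, one_smul]
  rfl

theorem ContOrientAt.prodOrient [IsManifold (𝓡 p) ∞ M] (h : ContOrientAt (𝓡 p) o x) :
    ContOrientAt (halfModel p) (prodOrient o) (x, t) := by
  obtain ⟨η, hη⟩ := h
  refine ⟨outwardWedge η, ?_⟩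
  rw [nhds_prod_eq]
  filter_upwards [(hη.and (chart_source_mem_nhds (EuclideanSpace ℝ (Fin p)) x)).prod_inl
    (𝓝 t)]
  rintro ⟨y, s⟩ ⟨⟨hne, e⟩, hy⟩
  have h0 : η ≠ 0 := by
    rintro rfl
    exact hne rfl
  have := (pulls_of_exists η h0 hne rfl e).prodOr_pos one_pos (chartEnd_prod (t₀ := t) (t := s) hy)
  exact this _ (outwardWedge_ne_zero h0) (prodOr_rayOfNeZero _ _)

end HalfProduct

/-! ### Oriented closed manifolds and fillings -/

section Fillings

open Set Filter

variable {p : ℕ}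

/-- The orientation of a closed manifold, with values in the orientations of the model space. -/
def ClosedManifold.or (N : ClosedManifold p) :
    N.carrier → Orientation ℝ (EuclideanSpace ℝ (Fin p)) (Fin p) :=
  N.orient

theorem ClosedManifold.contOrientAt (N : ClosedManifold p) (x : N.carrier) :
    ContOrientAt (𝓡 p) N.or x :=
  N.orient_continuous x

/-- The orientation of a filling, with values in the orientations of the model space. -/
def Filling.or {N : ClosedManifold p} (W : Filling N) :
    W.carrier → Orientation ℝ (HalfSpaceVec p) (Fin (p + 1)) :=
  W.orient

theorem Filling.contOrientAt {N : ClosedManifold p} (W : Filling N) (x : W.carrier) :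
    ContOrientAt (halfModel p) W.or x :=
  W.orient_continuous x

theorem Filling.collar_pulls_zero {N : ClosedManifold p} (W : Filling N) (x : N.carrier) :
    Pulls (derivAt (halfModel p) W.collar (x, 0)) (W.or (W.collar (x, 0))) (prodOr (N.or x)) :=
  boundaryForm_iff_pulls.1 (W.collar_orient x)

/-- A filling constrains the orientation of its collar only over `N × {0}`. The pulled-back and the
product orientation are both continuous and agree at `(x, 0)`, hence along the connected ray `{x} ×
[0, ∞)`. -/
theorem Filling.collar_oriented {N : ClosedManifold p} (W : Filling N)
    (z : N.carrier × EuclideanHalfSpace 1) :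
    OrientedAt (halfModel p) (prodOrient N.or) W.or W.collar z := by
  obtain ⟨oc, hoc⟩ := exists_orientation_pulls (I := halfModel p) W.collar_diffeo W.or
  have h₁ (z) : ContOrientAt (halfModel p) oc z :=
    ContOrientAt.comap finrank_halfSpaceVec (Eventually.of_forall hoc) (W.contOrientAt _)
  have h₂ (z) : ContOrientAt (halfModel p) (prodOrient N.or) z := (N.contOrientAt z.1).prodOrient
  have h₃ : oc (z.1, 0) = prodOrient N.or (z.1, 0) :=
    (hoc (z.1, 0)).pulls.unique_right (W.collar_pulls_zero z.1)
  have hs : IsPreconnected (({z.1} : Set N.carrier) ×ˢ (univ : Set (EuclideanHalfSpace 1))) :=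
    isPreconnected_singleton.prod isPreconnected_univ
  have h₄ := eq_of_contOrientAt_of_isPreconnected finrank_halfSpaceVec h₁ h₂ hs
    (x := (z.1, 0)) (y := z) (by simp) (by simp) h₃
  exact ⟨W.collar_diffeo z, h₄ ▸ (hoc z).pulls⟩

/-- A compact oriented manifold with an oriented collar is a filling. -/
def Filling.ofCollar (N : ClosedManifold p) (W : Type) [TopologicalSpace W]
    [ChartedSpace (HalfSpace p) W] [IsManifold (halfModel p) ∞ W] [CompactSpace W] [T2Space W]
    (oW : W → Orientation ℝ (HalfSpaceVec p) (Fin (p + 1)))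
    (hoW : ∀ x, ContOrientAt (halfModel p) oW x) (c : N.carrier × EuclideanHalfSpace 1 → W)
    (hinj : Function.Injective c)
    (hc : ∀ z, OrientedAt (halfModel p) (prodOrient N.or) oW c z)
    (hb : range (fun x : N.carrier => c (x, 0)) = (halfModel p).boundary W) : Filling N where
  carrier := W
  orient := oW
  orient_continuous := hoW
  collar := c
  collar_injective := hinj
  collar_diffeo z := (hc z).diffeo
  collar_boundary := hb
  collar_orient x := boundaryForm_iff_pulls.2 (hc (x, 0)).pulls

/-! ### Orientations of disjoint unions -/

section Sum

variable {n : ℕ} {E H : Type*} [NormedAddCommGroup E] [NormedSpace ℝ E] [TopologicalSpace H]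
  {I : ModelWithCorners ℝ E H} {M N : Type*} [TopologicalSpace M] [ChartedSpace H M]
  [TopologicalSpace N] [ChartedSpace H N]

theorem orientedAt_inl [IsManifold I ∞ M] [IsManifold I ∞ N] (o : M → Orientation ℝ E (Fin n))
    (o' : N → Orientation ℝ E (Fin n)) (x : M) :
    OrientedAt I o (Sum.elim o o') (Sum.inl : M → M ⊕ N) x where
  diffeo := isLocalDiffeomorphAt_inl x
  pulls := by
    have : derivAt I (Sum.inl : M → M ⊕ N) x = LinearMap.id := by
      rw [derivAt, (hasMFDerivAt_inl (I := I) (M' := N) (q := x) (p := Sum.inl x)).mfderiv]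
      rfl
    rw [this]
    exact pulls_id _

theorem orientedAt_inr [IsManifold I ∞ M] [IsManifold I ∞ N] (o : M → Orientation ℝ E (Fin n))
    (o' : N → Orientation ℝ E (Fin n)) (x : N) :
    OrientedAt I o' (Sum.elim o o') (Sum.inr : N → M ⊕ N) x where
  diffeo := isLocalDiffeomorphAt_inr x
  pulls := by
    have : derivAt I (Sum.inr : N → M ⊕ N) x = LinearMap.id := by
      rw [derivAt, (hasMFDerivAt_inr (I := I) (M := M) (q' := x) (p := Sum.inr x)).mfderiv]
      rfl
    rw [this]
    exact pulls_id _

theorem contOrientAt_sumElim [FiniteDimensional ℝ E] [IsManifold I ∞ M] [IsManifold I ∞ N]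
    (hn : Module.finrank ℝ E = n) {o : M → Orientation ℝ E (Fin n)}
    {o' : N → Orientation ℝ E (Fin n)} (h : ∀ x, ContOrientAt I o x)
    (h' : ∀ x, ContOrientAt I o' x) (x : M ⊕ N) : ContOrientAt I (Sum.elim o o') x := by
  rcases x with x | x
  · exact (h x).map hn (Eventually.of_forall (orientedAt_inl o o'))
  · exact (h' x).map hn (Eventually.of_forall (orientedAt_inr o o'))

end Sum

namespace ClosedManifold

variable (M N : ClosedManifold p)

theorem sum_or : (M.sum N).or = Sum.elim M.or N.or := by
  funext x
  rcases x with x | x <;> rfl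

/-- The inclusion of the first summand of a disjoint union. -/
def inl (x : M.carrier) : (M.sum N).carrier := Sum.inl x

/-- The inclusion of the second summand of a disjoint union. -/
def inr (x : N.carrier) : (M.sum N).carrier := Sum.inr x

theorem inl_oriented (x : M.carrier) : OrientedAt (𝓡 p) M.or (M.sum N).or (M.inl N) x := by
  rw [sum_or]
  exact orientedAt_inl M.or N.or x

theorem inr_oriented (x : N.carrier) : OrientedAt (𝓡 p) N.or (M.sum N).or (M.inr N) x := by
  rw [sum_or]
  exact orientedAt_inr M.or N.or x

variable {M N}

theorem sum_cases {P : (M.sum N).carrier → Prop} (hl : ∀ x, P (M.inl N x))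
    (hr : ∀ x, P (M.inr N x)) (x : (M.sum N).carrier) : P x := by
  rcases x with x | x
  exacts [hl x, hr x]

/-- The map out of a disjoint union with given restrictions to the summands. -/
def elim {A : Type*} (f : M.carrier → A) (g : N.carrier → A) : (M.sum N).carrier → A :=
  Sum.elim f g

theorem elim_oriented {P : Type*} [TopologicalSpace P] [ChartedSpace (EuclideanSpace ℝ (Fin p)) P]
    {o : P → Orientation ℝ (EuclideanSpace ℝ (Fin p)) (Fin p)} {f : M.carrier → P}
    {g : N.carrier → P} (hf : ∀ x, OrientedAt (𝓡 p) M.or o f x)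
    (hg : ∀ x, OrientedAt (𝓡 p) N.or o g x) (x : (M.sum N).carrier) :
    OrientedAt (𝓡 p) (M.sum N).or o (elim f g) x := by
  revert x
  refine sum_cases (fun x => ?_) fun x => ?_
  · exact (inl_oriented M N x).of_comp_right (hf x)
  · exact (inr_oriented M N x).of_comp_right (hg x)

theorem inl_injective : Function.Injective (M.inl N) := Sum.inl_injective

theorem inr_injective : Function.Injective (M.inr N) := Sum.inr_injective

theorem inl_ne_inr (x : M.carrier) (y : N.carrier) : M.inl N x ≠ M.inr N y := Sum.inl_ne_inr

theorem continuous_inl : Continuous (M.inl N) := _root_.continuous_inl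

theorem continuous_inr : Continuous (M.inr N) := _root_.continuous_inr

theorem continuous_elim {A : Type*} [TopologicalSpace A] {f : M.carrier → A} {g : N.carrier → A}
    (hf : Continuous f) (hg : Continuous g) : Continuous (elim f g) := hf.sumElim hg

/-- The identity, as a map from `M` to the manifold `-M`. -/
def toNeg (M : ClosedManifold p) (x : M.carrier) : M.neg.carrier := x

theorem toNeg_oriented (x : M.carrier) :
    OrientedAt (𝓡 p) (fun y => -M.or y) M.neg.or M.toNeg x :=
  orientedAt_id (fun y : M.carrier => -M.or y) x

end ClosedManifold

/-! ### Singular manifolds that bound -/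

variable {T : Type*} [TopologicalSpace T]

/-- The singular manifold `s` is the boundary of a map from a compact oriented manifold. -/
def Bounds (s : SingularMfd p T) : Prop :=
  ∃ (W : Filling s.dom) (K : C(W.carrier, T)), ∀ x, K (W.bd x) = s.map x

/-- The singular manifold `s` with the opposite orientation of its domain. -/
def SingularMfd.neg (s : SingularMfd p T) : SingularMfd p T where
  dom := s.dom.neg
  map := s.map

/-- The same manifold serves, with its collar reparametrized by `e`. -/
theorem Bounds.congr {s t : SingularMfd p T} (h : Bounds s) (e : t.dom.carrier → s.dom.carrier)
    (he : Function.Bijective e) (ho : ∀ x, OrientedAt (𝓡 p) t.dom.or s.dom.or e x)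
    (hm : ∀ x, s.map (e x) = t.map x) : Bounds t := by
  obtain ⟨W, K, hK⟩ := h
  refine ⟨Filling.ofCollar t.dom W.carrier W.or W.contOrientAt (W.collar ∘ Prod.map e id)
    (W.collar_injective.comp (he.1.prodMap Function.injective_id)) ?_ ?_, K, ?_⟩
  · rintro ⟨x, r⟩
    exact (W.collar_oriented _).comp ((ho x).prodMap_pos (halfDiffeoAt_id r) one_pos)
  · rw [← W.collar_boundary]
    exact he.2.range_comp (fun x => W.collar (x, 0))
  · intro x
    exact (hK (e x)).trans (hm x)

theorem Bounds.neg {s : SingularMfd p T} (h : Bounds s) : Bounds s.neg := by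
  obtain ⟨W, K, hK⟩ := h
  refine ⟨Filling.ofCollar s.dom.neg W.carrier (fun x => -W.or x)
    (fun x => (W.contOrientAt x).neg) W.collar W.collar_injective ?_ W.collar_boundary, K, hK⟩
  intro z
  have := (W.collar_oriented z).neg
  have e : (fun y => -prodOrient s.dom.or y) = prodOrient s.dom.neg.or := by
    funext y
    exact (prodOr_neg _).symm
  rw [e] at this
  exact this

theorem Bounds.sum {s t : SingularMfd p T} (hs : Bounds s) (ht : Bounds t) :
    Bounds (s.sum t) := by
  obtain ⟨W, K, hK⟩ := hs
  obtain ⟨W', K', hK'⟩ := ht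
  let c : (s.dom.sum t.dom).carrier × EuclideanHalfSpace 1 → W.carrier ⊕ W'.carrier := fun z =>
    ClosedManifold.elim (fun x => Sum.inl (W.collar (x, z.2)))
      (fun x => Sum.inr (W'.collar (x, z.2))) z.1
  refine ⟨Filling.ofCollar (s.dom.sum t.dom) (W.carrier ⊕ W'.carrier) (Sum.elim W.or W'.or)
    (contOrientAt_sumElim finrank_halfSpaceVec W.contOrientAt W'.contOrientAt) c ?_ ?_ ?_,
    ⟨Sum.elim K K', K.continuous.sumElim K'.continuous⟩, ?_⟩
  · rintro ⟨x, r⟩ ⟨y, r'⟩ h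
    rcases x with x | x <;> rcases y with y | y
    · have := W.collar_injective (Sum.inl_injective h)
      simp only [Prod.mk.injEq] at this
      rw [this.1, this.2]
    · exact absurd h Sum.inl_ne_inr
    · exact absurd h Sum.inr_ne_inl
    · have := W'.collar_injective (Sum.inr_injective h)
      simp only [Prod.mk.injEq] at this
      rw [this.1, this.2]
  · rintro ⟨x, r⟩
    revert x
    refine ClosedManifold.sum_cases (fun x => ?_) fun x => ?_
    · have h₁ := (ClosedManifold.inl_oriented s.dom t.dom x).prodMap_pos (halfDiffeoAt_id r) one_pos
      exact h₁.of_comp_right ((orientedAt_inl W.or W'.or _).comp (W.collar_oriented (x, r)))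
    · have h₁ := (ClosedManifold.inr_oriented s.dom t.dom x).prodMap_pos (halfDiffeoAt_id r) one_pos
      exact h₁.of_comp_right ((orientedAt_inr W.or W'.or _).comp (W'.collar_oriented (x, r)))
  · rw [ModelWithCorners.boundary_disjointUnion, ← W.collar_boundary, ← W'.collar_boundary,
      ← range_comp, ← range_comp]
    exact Sum.elim_range (fun x => (Sum.inl (W.collar (x, 0)) : W.carrier ⊕ W'.carrier))
      (fun x => Sum.inr (W'.collar (x, 0)))
  · rintro (x | x)
    · exact hK x
    · exact hK' x

end Fillings

section Cylinder

open Set Filter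

variable {p : ℕ}

/-! ### The interchange of the two ends of `M ⊔ -M` -/

namespace ClosedManifold

variable (M : ClosedManifold p)

/-- The orientation reversing involution of `M ⊔ -M` that interchanges the summands. -/
def swap : (M.sum M.neg).carrier → (M.sum M.neg).carrier :=
  elim (fun x => M.inr M.neg x) (fun x => M.inl M.neg x)

theorem swap_swap (x : (M.sum M.neg).carrier) : M.swap (M.swap x) = x := by
  rcases x with x | x <;> rfl

theorem swap_ne (x : (M.sum M.neg).carrier) : M.swap x ≠ x := by
  rcases x with x | x
  · exact Sum.inr_ne_inl
  · exact Sum.inl_ne_inr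

theorem continuous_swap : Continuous M.swap := continuous_elim continuous_inr continuous_inl

theorem swap_oriented (x : (M.sum M.neg).carrier) :
    OrientedAt (𝓡 p) (fun y => -(M.sum M.neg).or y) (M.sum M.neg).or M.swap x := by
  revert x
  refine sum_cases (fun x => ?_) fun x => ?_
  · have h₁ : OrientedAt (𝓡 p) (fun y => -M.or y) (M.sum M.neg).or (M.inr M.neg ∘ M.toNeg) x :=
      (inr_oriented M M.neg x).comp (toNeg_oriented x)
    exact (inl_oriented M M.neg x).neg.of_comp_right h₁
  · have h₁ : OrientedAt (𝓡 p) (fun y => -M.neg.or y) M.or (id : M.carrier → M.carrier) x := by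
      have e : (fun y => -M.neg.or y) = M.or := by
        funext y
        exact neg_neg (M.or y)
      rw [e]
      exact orientedAt_id M.or x
    have h₂ : OrientedAt (𝓡 p) (fun y => -M.neg.or y) (M.sum M.neg).or
        (M.inl M.neg ∘ (id : M.carrier → M.carrier)) x :=
      (inl_oriented M M.neg x).comp h₁
    exact (inr_oriented M M.neg x).neg.of_comp_right h₂

end ClosedManifold

/-! ### The cylinder -/

/-- A surjective local diffeomorphism is open, hence a quotient map, so compatible continuous maps
descend. -/
theorem exists_continuousMap_of_oriented_surjective {n : ℕ} {E H V Q T : Type*}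
    [NormedAddCommGroup E] [NormedSpace ℝ E] [TopologicalSpace H] {I : ModelWithCorners ℝ E H}
    [TopologicalSpace V] [ChartedSpace H V] [TopologicalSpace Q] [ChartedSpace H Q]
    [TopologicalSpace T] {o : V → Orientation ℝ E (Fin n)} {oQ : Q → Orientation ℝ E (Fin n)}
    {q : V → Q} (hq : ∀ x, OrientedAt I o oQ q x) (hs : Function.Surjective q) (k : C(V, T))
    (hk : ∀ x y, q x = q y → k x = k y) : ∃ K : C(Q, T), ∀ x, K (q x) = k x := by
  have hl : IsLocalDiffeomorph I I ∞ q := fun x => (hq x).diffeo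
  let q' : C(V, Q) := ⟨q, hl.contMDiff.continuous⟩
  have hQ : Topology.IsQuotientMap q' := hl.isOpenMap.isQuotientMap hl.contMDiff.continuous hs
  have hk' : Function.FactorsThrough k q' := fun x y h => hk x y h
  exact ⟨hQ.lift k hk', fun x => congrArg (fun f : C(V, T) => f x) (hQ.lift_comp k hk')⟩

instance : T2Space (EuclideanHalfSpace 1) :=
  T2Space.of_injective_continuous halfCoord_injective continuous_halfCoord

theorem boundary_prod_half (N : ClosedManifold p) (z : N.carrier × EuclideanHalfSpace 1) :
    (halfModel p).IsBoundaryPoint z ↔ z.2 = 0 := by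
  have h₁ : z ∈ (halfModel p).boundary (N.carrier × EuclideanHalfSpace 1) ↔
      z.2 ∈ (𝓡∂ 1).boundary (EuclideanHalfSpace 1) := by
    rw [ModelWithCorners.boundary_of_boundaryless_left]
    exact ⟨fun h => h.2, fun h => ⟨trivial, h⟩⟩
  have h₂ : z.2 ∈ (𝓡∂ 1).boundary (EuclideanHalfSpace 1) ↔ 0 = halfCoord z.2 := by
    change extChartAt (𝓡∂ 1) z.2 z.2 ∈ frontier (range (𝓡∂ 1)) ↔ _
    rw [frontier_range_modelWithCornersEuclideanHalfSpace]
    rfl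
  refine h₁.trans (h₂.trans ⟨fun h => halfCoord_injective h.symm, fun h => ?_⟩)
  rw [h, halfCoord_zero]

theorem isCompact_halfCoord_le (r : ℝ) : IsCompact {t : EuclideanHalfSpace 1 | halfCoord t ≤ r} := by
  have h : {t : EuclideanHalfSpace 1 | halfCoord t ≤ r} = mkHalf '' Icc 0 r := by
    ext t
    constructor
    · intro ht
      exact ⟨halfCoord t, ⟨halfCoord_nonneg t, ht⟩, mkHalf_halfCoord t⟩
    · rintro ⟨s, hs, rfl⟩
      simpa [hs.1] using hs.2
  rw [h]
  exact isCompact_Icc.image continuous_mkHalf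

variable {T : Type*} [TopologicalSpace T]

/-- The cylinder arises from `(M ⊔ -M) × [0, ∞)` by identifying the two copies of `M × (0, ∞)`
through `t ↦ 1/t`, which turns two half-lines into one closed interval. Orientation, boundary and
collar are then inherited from the half-lines. -/
theorem bounds_sum_neg (s : SingularMfd p T) : Bounds (s.sum s.neg) := by
  set M := s.dom with hM
  let N := M.sum M.neg
  let o := prodOrient N.or
  have ho (z) : ContOrientAt (halfModel p) o z := (N.contOrientAt z.1).prodOrient
  -- Written as an equation, the relation is visibly closed, and it never involves points with `t =
  -- 0`.
  let R : N.carrier × EuclideanHalfSpace 1 → N.carrier × EuclideanHalfSpace 1 → Prop :=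
    fun z w => w.1 = M.swap z.1 ∧ halfCoord z.2 * halfCoord w.2 = 1
  have hclosed : IsClosed {z : (N.carrier × EuclideanHalfSpace 1) ×
      (N.carrier × EuclideanHalfSpace 1) | R z.1 z.2} := by
    have c₁ := M.continuous_swap
    have c₂ := continuous_halfCoord
    exact (isClosed_eq (by fun_prop) (by fun_prop)).inter (isClosed_eq (by fun_prop) (by fun_prop))
  obtain ⟨Q, _, _, _, _, oQ, q, hsurj, hoQ, hq, hqq⟩ := exists_oriented_quotient
    (I := halfModel p) finrank_halfSpaceVec ho R hclosed
    (fun z h => M.swap_ne z.1 h.1.symm)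
    (fun z w h => ⟨by rw [h.1, M.swap_swap], by rw [mul_comm]; exact h.2⟩)
    (by
      intro z w u h h'
      have hw : halfCoord w.2 ≠ 0 := right_ne_zero_of_mul_eq_one h.2
      refine Prod.ext (by rw [h'.1, h.1, M.swap_swap]) (halfCoord_injective ?_)
      have := h.2.trans h'.2.symm
      rw [mul_comm] at this
      exact mul_left_cancel₀ hw this)
    (by
      intro z w h
      have hz : 0 < halfCoord z.2 :=
        lt_of_le_of_ne (halfCoord_nonneg _) (left_ne_zero_of_mul_eq_one h.2).symm
      refine ⟨N.carrier × EuclideanHalfSpace 1, inferInstance, inferInstance, o, z, id,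
        Prod.map M.swap (halfMap fun s => s⁻¹), rfl, ?_, ?_⟩
      · refine Prod.ext h.1.symm (halfCoord_injective ?_)
        have : (halfCoord z.2)⁻¹ = halfCoord w.2 := inv_eq_of_mul_eq_one_right h.2
        simp [halfMap, this, halfCoord_nonneg]
      · have : ∀ᶠ u in 𝓝 z, 0 < halfCoord u.2 :=
          (continuous_halfCoord.comp continuous_snd).continuousAt.eventually (Ioi_mem_nhds hz)
        filter_upwards [this] with u hu
        obtain ⟨a, ha, hd⟩ := halfDiffeoAt_inv hu
        refine ⟨orientedAt_id o u, (M.swap_oriented u.1).prodMap_neg hd ha, rfl, ?_⟩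
        have : 0 ≤ (halfCoord u.2)⁻¹ := by positivity
        simp [halfMap, this, hu.ne'])
  have hqc : Continuous q :=
    continuous_iff_continuousAt.2 fun x => (hq x).diffeo.contMDiffAt.continuousAt
  -- Of two partners one has coordinate at most `1`, so the compact part `t ≤ 1` already covers the
  -- quotient.
  have hcompact : CompactSpace Q := by
    have hC : IsCompact ((univ : Set N.carrier) ×ˢ {t : EuclideanHalfSpace 1 | halfCoord t ≤ 1}) :=
      isCompact_univ.prod (isCompact_halfCoord_le 1)
    refine ⟨?_⟩
    have e : (univ : Set Q) =
        q '' ((univ : Set N.carrier) ×ˢ {t : EuclideanHalfSpace 1 | halfCoord t ≤ 1}) := by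
      refine (eq_univ_of_forall fun y => ?_).symm
      obtain ⟨⟨x, t⟩, rfl⟩ := hsurj y
      rcases le_total (halfCoord t) 1 with ht | ht
      · exact ⟨(x, t), ⟨trivial, ht⟩, rfl⟩
      · have hpos : 0 < halfCoord t := by linarith
        have hinv : 0 ≤ (halfCoord t)⁻¹ := by positivity
        refine ⟨(M.swap x, mkHalf (halfCoord t)⁻¹), ⟨trivial, ?_⟩, ?_⟩
        · simpa using inv_le_one_of_one_le₀ ht
        · refine (hqq _ _).2 (Or.inr ⟨(M.swap_swap x).symm, ?_⟩)
          simp [hinv, hpos.ne']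
    rw [e]
    exact hC.image hqc
  -- The collar is squeezed into `t < 1`, where products of coordinates stay below `1` and no two
  -- points are identified.
  let θ : EuclideanHalfSpace 1 → EuclideanHalfSpace 1 := halfMap fun s => s / (1 + s)
  have hθ (t) : halfCoord (θ t) = halfCoord t / (1 + halfCoord t) := by
    have := halfCoord_nonneg t
    exact max_eq_left (by positivity)
  have hθ1 (t) : halfCoord (θ t) < 1 := by
    have := halfCoord_nonneg t
    rw [hθ, div_lt_one (by positivity)]
    linarith
  have hθ0 : θ 0 = 0 := halfCoord_injective (by rw [hθ]; simp)
  have hθi : Function.Injective θ := by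
    intro a b h
    have h' := congrArg halfCoord h
    have ha := halfCoord_nonneg a
    have hb := halfCoord_nonneg b
    rw [hθ, hθ, div_eq_div_iff (by positivity) (by positivity)] at h'
    exact halfCoord_injective (by linarith)
  let k : C(N.carrier × EuclideanHalfSpace 1, T) :=
    ⟨fun z => (s.sum s.neg).map z.1, by fun_prop⟩
  obtain ⟨K, hK⟩ := exists_continuousMap_of_oriented_surjective hq hsurj k (by
    intro z w h
    rcases (hqq _ _).1 h with rfl | h
    · rfl
    · change (s.sum s.neg).map z.1 = (s.sum s.neg).map w.1
      rw [h.1]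
      rcases z.1 with x | x <;> rfl)
  refine ⟨Filling.ofCollar N Q oQ hoQ (q ∘ Prod.map id θ) ?_ ?_ ?_, K, ?_⟩
  · rintro ⟨x, a⟩ ⟨y, b⟩ h
    rcases (hqq _ _).1 h with h | h
    · exact (Function.injective_id.prodMap hθi) h
    · have h₂ : halfCoord (θ a) * halfCoord (θ b) = 1 := h.2
      have := mul_lt_one_of_nonneg_of_lt_one_left (halfCoord_nonneg (θ a)) (hθ1 a) (hθ1 b).le
      linarith
  · rintro ⟨x, t⟩
    obtain ⟨a, ha, hd⟩ := halfDiffeoAt_shrink t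
    exact (hq _).comp ((orientedAt_id N.or x).prodMap_pos hd ha)
  · ext y
    obtain ⟨⟨x, t⟩, rfl⟩ := hsurj y
    have h₁ : q (x, t) ∈ (halfModel p).boundary Q ↔ t = 0 :=
      ((hq (x, t)).diffeo.isBoundaryPoint_iff (by simp)).symm.trans (boundary_prod_half N (x, t))
    rw [h₁]
    constructor
    · rintro ⟨x', h⟩
      have h' : q (x', 0) = q (x, t) := by
        rw [← hθ0]
        exact h
      rcases (hqq _ _).1 h' with h | h
      · exact (Prod.ext_iff.1 h).2.symm
      · have := h.2
        simp at this
    · rintro rfl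
      refine ⟨x, ?_⟩
      change q (x, θ 0) = q (x, 0)
      rw [hθ0]
  · intro x
    change K (q (x, θ 0)) = _
    rw [hK]
    rfl

end Cylinder

section Gluing

open Set Filter

/-! ### Gluing along a pair of boundary components -/

open Classical in
/-- The map `φ`, with values restricted to the open set `U`. -/
def corestrict {P W : Type*} [TopologicalSpace W] {U : TopologicalSpace.Opens W} (d : U)
    (φ : P → W) (z : P) : U :=
  if h : φ z ∈ U then ⟨φ z, h⟩ else d

theorem coe_corestrict {P W : Type*} [TopologicalSpace W] {U : TopologicalSpace.Opens W} {d : U}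
    {φ : P → W} {z : P} (h : φ z ∈ U) : (corestrict d φ z : W) = φ z := by
  simp [corestrict, h]

/-- Near `z` the values lie in the open set `U`, so the default `d` is irrelevant there and the
inclusion of `U` can be cancelled. -/
theorem OrientedAt.corestrict {n : ℕ} {E H P W : Type*}
    [NormedAddCommGroup E] [NormedSpace ℝ E] [TopologicalSpace H] {I : ModelWithCorners ℝ E H}
    [TopologicalSpace P] [ChartedSpace H P] [TopologicalSpace W] [ChartedSpace H W]
    {U : TopologicalSpace.Opens W} {oP : P → Orientation ℝ E (Fin n)}
    {oU : U → Orientation ℝ E (Fin n)} {oW : W → Orientation ℝ E (Fin n)}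
    (hU : ∀ x, OrientedAt I oU oW (Subtype.val : U → W) x) {d : U} {φ : P → W} {z : P}
    (hφ : OrientedAt I oP oW φ z) (hz : φ z ∈ U) : OrientedAt I oP oU (corestrict d φ) z := by
  have hc : ContinuousAt φ z := hφ.diffeo.contMDiffAt.continuousAt
  have e : φ =ᶠ[𝓝 z] (Subtype.val : U → W) ∘ NielsenBordism.corestrict d φ := by
    filter_upwards [hc.eventually (U.isOpen.mem_nhds hz)] with y hy
    exact (coe_corestrict hy).symm
  exact (hU _).of_comp_left (hφ.congr e)
    (Topology.IsInducing.subtypeVal.continuousAt_iff.2 (hc.congr e))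

/-- A map on a space with an open embedded collar `B × [0, ∞)` can be deformed so that it is
constant in the direction of the collar on `B × [0, 1]`, without changing it off the collar. -/
theorem exists_constant_on_collar {B W T : Type*} [TopologicalSpace B] [CompactSpace B]
    [TopologicalSpace W] [T2Space W] [TopologicalSpace T] {c : B × EuclideanHalfSpace 1 → W}
    (hc : Topology.IsOpenEmbedding c) (K : C(W, T)) :
    ∃ k : C(W, T), (∀ b t, halfCoord t ≤ 1 → k (c (b, t)) = K (c (b, 0))) ∧
      ∀ w ∉ range c, k w = K w := by
  -- `ρ` is `0` up to `1`, equals `2 t - 2` between `1` and `2`, and is the identity from `2` on.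
  let ρ : ℝ → ℝ := fun t => max 0 (min t (2 * t - 2))
  let g : B × EuclideanHalfSpace 1 → T := fun z => K (c (z.1, mkHalf (ρ (halfCoord z.2))))
  have hg : Continuous g := by
    have c₁ := continuous_halfCoord
    have c₂ := continuous_mkHalf
    have c₃ := hc.continuous
    fun_prop
  have e₁ (z) : Function.extend c g K (c z) = g z := hc.injective.extend_apply _ _ _
  refine ⟨⟨Function.extend c g K, continuous_iff_continuousAt.2 fun w => ?_⟩, ?_, ?_⟩
  · by_cases hw : w ∈ range c
    · obtain ⟨z, rfl⟩ := hw
      rw [← hc.continuousAt_iff]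
      exact hg.continuousAt.congr (Eventually.of_forall fun z => (e₁ z).symm)
    -- The collar up to height `2` is compact, hence closed; on its complement the new map is `K`,
    -- which gives continuity at points off the collar.
    · have hC : IsClosed (c '' (univ ×ˢ {t | halfCoord t ≤ 2})) :=
        ((isCompact_univ.prod (isCompact_halfCoord_le 2)).image hc.continuous).isClosed
      have hw' : w ∉ c '' (univ ×ˢ {t | halfCoord t ≤ 2}) := fun ⟨z, _, h⟩ => hw ⟨z, h⟩
      refine K.continuous.continuousAt.congr ?_
      filter_upwards [hC.isOpen_compl.mem_nhds hw'] with y hy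
      by_cases hy' : y ∈ range c
      · obtain ⟨⟨b, t⟩, rfl⟩ := hy'
        have ht : 2 < halfCoord t := by
          by_contra! h
          exact hy ⟨(b, t), ⟨trivial, h⟩, rfl⟩
        have hρ : ρ (halfCoord t) = halfCoord t := by
          simp only [ρ]
          rw [min_eq_left (by linarith), max_eq_right (by linarith)]
        rw [e₁]
        simp only [g, hρ, mkHalf_halfCoord]
      · exact (Function.extend_apply' _ _ _ hy').symm
  · intro b t ht
    have hρ : ρ (halfCoord t) = 0 := max_eq_left (min_le_of_right_le (by linarith))
    change Function.extend c g K (c (b, t)) = _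
    rw [e₁]
    simp only [g, hρ, mkHalf_zero]
  · intro w hw
    exact Function.extend_apply' g K w hw

variable {p : ℕ} {T : Type*} [TopologicalSpace T]

/-- The boundary pieces `M` and `-M` are removed and their open collars of height `1` overlapped
back to front. Since `K` respects `swap` only on the removed boundary, it is first made constant
along these collars so that it descends. -/
theorem Bounds.glue {s t : SingularMfd p T} (h : Bounds (s.sum (t.sum t.neg))) : Bounds s := by
  obtain ⟨W, K, hK⟩ := h
  set A := s.dom with hA
  set M := t.dom with hM
  let B := M.sum M.neg
  let cA : A.carrier × EuclideanHalfSpace 1 → W.carrier := fun z => W.collar (A.inl B z.1, z.2)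
  let cB : B.carrier × EuclideanHalfSpace 1 → W.carrier := fun z => W.collar (A.inr B z.1, z.2)
  have hcA (z) : OrientedAt (halfModel p) (prodOrient A.or) W.or cA z :=
    (W.collar_oriented _).comp ((A.inl_oriented B z.1).prodMap_pos (halfDiffeoAt_id z.2) one_pos)
  have hcB (z) : OrientedAt (halfModel p) (prodOrient B.or) W.or cB z :=
    (W.collar_oriented _).comp ((A.inr_oriented B z.1).prodMap_pos (halfDiffeoAt_id z.2) one_pos)
  have hiA : Function.Injective cA := by
    rintro ⟨a, r⟩ ⟨b, r'⟩ h
    have := Prod.mk.inj (W.collar_injective h)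
    exact Prod.ext (ClosedManifold.inl_injective this.1) this.2
  have hiB : Function.Injective cB := by
    rintro ⟨a, r⟩ ⟨b, r'⟩ h
    have := Prod.mk.inj (W.collar_injective h)
    exact Prod.ext (ClosedManifold.inr_injective this.1) this.2
  have hAB (z w) : cA z ≠ cB w := fun h =>
    ClosedManifold.inl_ne_inr _ _ (Prod.mk.inj (W.collar_injective h)).1
  have hlB : IsLocalDiffeomorph (halfModel p) (halfModel p) ∞ cB := fun z => (hcB z).diffeo
  have hcontB : Continuous cB := hlB.contMDiff.continuous
  have hopen : Topology.IsOpenEmbedding cB :=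
    Topology.IsOpenEmbedding.of_continuous_injective_isOpenMap hcontB hiB hlB.isOpenMap
  let V : TopologicalSpace.Opens W.carrier :=
    ⟨(range fun b => cB (b, 0))ᶜ,
      (isCompact_range (hcontB.comp (by fun_prop))).isClosed.isOpen_compl⟩
  have hVA (z) : cA z ∈ V := by
    rintro ⟨b, h⟩
    exact hAB _ _ h.symm
  have hVB {b t} : cB (b, t) ∈ V ↔ 0 < halfCoord t := by
    constructor
    · intro h
      refine lt_of_le_of_ne (halfCoord_nonneg t) fun h' => h ⟨b, ?_⟩
      have : t = 0 := halfCoord_injective h'.symm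
      rw [this]
    · rintro h ⟨b', h'⟩
      have := (Prod.mk.inj (hiB h')).2
      rw [← this] at h
      simp at h
  obtain ⟨oV, hoV⟩ := exists_orientation_pulls (I := halfModel p)
    (isLocalDiffeomorphAt_subtypeVal V) W.or
  have hcV (x) : ContOrientAt (halfModel p) oV x :=
    ContOrientAt.comap finrank_halfSpaceVec (Eventually.of_forall hoV) (W.contOrientAt _)
  let σ : B.carrier × EuclideanHalfSpace 1 → W.carrier :=
    cB ∘ Prod.map M.swap (halfMap fun s => 1 - s)
  -- The condition `t ≤ 1` makes `R` the trace on `V × V` of a compact set, hence closed. Since `V`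
  -- omits the boundary piece, both points lying in `V` forces `0 < t < 1`.
  let R : V → V → Prop := fun v w =>
    ∃ b t, halfCoord t ≤ 1 ∧ v.1 = cB (b, t) ∧ w.1 = cB (M.swap b, halfMap (fun s => 1 - s) t)
  have hcoord {t} (ht : halfCoord t ≤ 1) :
      halfCoord (halfMap (fun s => 1 - s) t) = 1 - halfCoord t := max_eq_left (by linarith)
  have hR {v w} (h : R v w) : ∃ b t, 0 < halfCoord t ∧ halfCoord t < 1 ∧ v.1 = cB (b, t) ∧
      w.1 = cB (M.swap b, halfMap (fun s => 1 - s) t) := by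
    obtain ⟨b, t, h₁, h₂, h₃⟩ := h
    have hv := v.2
    have hw := w.2
    rw [h₂] at hv
    rw [h₃] at hw
    have h₄ := hVB.1 hv
    have h₅ := hVB.1 hw
    rw [hcoord h₁] at h₅
    exact ⟨b, t, h₄, by linarith, h₂, h₃⟩
  have hclosed : IsClosed {z : V × V | R z.1 z.2} := by
    have hC : IsCompact ((fun z => (cB z, σ z)) '' (univ ×ˢ {t | halfCoord t ≤ 1})) := by
      refine (isCompact_univ.prod (isCompact_halfCoord_le 1)).image (hcontB.prodMk ?_)
      refine hcontB.comp (M.continuous_swap.prodMap ?_)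
      exact continuous_mkHalf.comp (continuous_const.sub continuous_halfCoord)
    have hp : Continuous fun z : V × V => (z.1.1, z.2.1) := by fun_prop
    convert hC.isClosed.preimage hp using 1
    ext z
    constructor
    · rintro ⟨b, t, h₁, h₂, h₃⟩
      exact ⟨(b, t), ⟨trivial, h₁⟩, Prod.ext h₂.symm h₃.symm⟩
    · rintro ⟨⟨b, t⟩, ⟨-, h₁⟩, h₂⟩
      exact ⟨b, t, h₁, (Prod.mk.inj h₂).1.symm, (Prod.mk.inj h₂).2.symm⟩
  have hinv {t} (h₀ : 0 < halfCoord t) (h₁ : halfCoord t < 1) :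
      halfMap (fun s => 1 - s) (halfMap (fun s => 1 - s) t) = t := by
    refine halfCoord_injective ?_
    rw [hcoord, hcoord h₁.le]
    · ring
    · rw [hcoord h₁.le]
      linarith
  obtain ⟨Q, _, _, _, _, oQ, q, hsurj, hoQ, hq, hqq⟩ := exists_oriented_quotient
    (I := halfModel p) finrank_halfSpaceVec hcV R hclosed
    (by
      rintro v ⟨b, t, -, h₁, h₂⟩
      exact M.swap_ne b (Prod.mk.inj (hiB (h₂.symm.trans h₁))).1)
    (by
      intro v w h
      obtain ⟨b, t, h₀, h₁, h₂, h₃⟩ := hR h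
      refine ⟨M.swap b, halfMap (fun s => 1 - s) t, ?_, h₃, ?_⟩
      · rw [hcoord h₁.le]
        linarith
      · rw [hinv h₀ h₁, M.swap_swap, h₂])
    (by
      intro u v w h h'
      obtain ⟨b, t, h₀, h₁, h₂, h₃⟩ := hR h
      obtain ⟨b', t', h₄, h₅⟩ := h'
      obtain ⟨e₁, e₂⟩ := Prod.mk.inj (hiB (h₃.symm.trans h₅.1))
      refine Subtype.ext ?_
      rw [h₅.2, ← e₁, ← e₂, hinv h₀ h₁, M.swap_swap, h₂])
    (by
      intro v w h
      obtain ⟨b, t, h₀, h₁, h₂, h₃⟩ := hR h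
      refine ⟨B.carrier × EuclideanHalfSpace 1, inferInstance, inferInstance, prodOrient B.or,
        (b, t), corestrict v cB, corestrict v σ, ?_, ?_, ?_⟩
      · exact Subtype.ext ((coe_corestrict (h₂ ▸ v.2)).trans h₂.symm)
      · have hw := w.2
        rw [h₃] at hw
        exact Subtype.ext ((coe_corestrict (φ := σ) (z := (b, t)) hw).trans h₃.symm)
      · have c₀ : ContinuousAt (fun z : B.carrier × EuclideanHalfSpace 1 => halfCoord z.2) (b, t) :=
          (continuous_halfCoord.comp continuous_snd).continuousAt
        filter_upwards [c₀.eventually (Ioi_mem_nhds h₀), c₀.eventually (Iio_mem_nhds h₁)]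
          with z hz₀ hz₁
        have m₁ : cB z ∈ V := hVB.2 hz₀
        have m₂ : σ z ∈ V := hVB.2 (by
          rw [hcoord (le_of_lt hz₁)]
          exact sub_pos.2 hz₁)
        refine ⟨(hcB z).corestrict hoV m₁, OrientedAt.corestrict hoV ?_ m₂, z.1, z.2, le_of_lt hz₁,
          coe_corestrict m₁, coe_corestrict m₂⟩
        exact (hcB _).comp
          ((M.swap_oriented z.1).prodMap_neg (halfDiffeoAt_one_sub hz₀ hz₁) (by norm_num)))
  have hqc : Continuous q :=
    continuous_iff_continuousAt.2 fun x => (hq x).diffeo.contMDiffAt.continuousAt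
  have hcompact : CompactSpace Q := by
    -- Removing the open collar of height `1 / 2` leaves a compact subset of `V`. It still meets
    -- every class, because a point at height `t < 1 / 2` has its partner at height `1 - t > 1 / 2`.
    let C : Set W.carrier := (cB '' (univ ×ˢ {t | halfCoord t < 1 / 2}))ᶜ
    have hC : IsCompact C := by
      refine (hlB.isOpenMap _ (isOpen_univ.prod ?_)).isClosed_compl.isCompact
      exact isOpen_lt continuous_halfCoord continuous_const
    have hCV : C ⊆ V := by
      rintro w hw ⟨b, rfl⟩
      exact hw ⟨(b, 0), ⟨trivial, by simp⟩, rfl⟩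
    have hC' : IsCompact ((Subtype.val : V → W.carrier) ⁻¹' C) := by
      rw [Subtype.isCompact_iff, image_preimage_eq_inter_range]
      have hr : C ⊆ range (Subtype.val : V → W.carrier) := fun w hw => ⟨⟨w, hCV hw⟩, rfl⟩
      rwa [inter_eq_left.2 hr]
    refine ⟨?_⟩
    have e : (univ : Set Q) = q '' ((Subtype.val : V → W.carrier) ⁻¹' C) := by
      refine (eq_univ_of_forall fun y => ?_).symm
      obtain ⟨v, rfl⟩ := hsurj y
      by_cases hv : v.1 ∈ C
      · exact ⟨v, hv, rfl⟩
      · obtain ⟨⟨b, t⟩, ⟨-, ht⟩, hbt⟩ := not_not.1 hv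
        have ht' : halfCoord t < 1 / 2 := ht
        have hm : cB (M.swap b, halfMap (fun s => 1 - s) t) ∈ V := hVB.2 (by
          rw [hcoord (by linarith)]
          linarith)
        refine ⟨⟨_, hm⟩, ?_, ((hqq _ _).2 (Or.inr ⟨b, t, by linarith, hbt.symm, rfl⟩)).symm⟩
        rintro ⟨⟨b', t'⟩, ⟨-, h₁⟩, h₂⟩
        have h₁' : halfCoord t' < 1 / 2 := h₁
        rw [(Prod.mk.inj (hiB h₂)).2, hcoord (by linarith)] at h₁'
        linarith
    rw [e]
    exact hC'.image hqc
  obtain ⟨k, hk₁, hk₂⟩ := exists_constant_on_collar hopen K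
  have hKB (b) : K (cB (M.swap b, 0)) = K (cB (b, 0)) := by
    refine (hK _).trans (Eq.trans ?_ (hK _).symm)
    rcases b with b | b <;> rfl
  obtain ⟨L, hL⟩ := exists_continuousMap_of_oriented_surjective hq hsurj
    (k.comp ⟨Subtype.val, continuous_subtype_val⟩) (by
    intro v w h
    rcases (hqq _ _).1 h with rfl | h
    · rfl
    · obtain ⟨b, t, h₀, h₁, h₂, h₃⟩ := hR h
      change k v.1 = k w.1
      rw [h₂, h₃, hk₁ _ _ h₁.le, hk₁ _ _ (by rw [hcoord h₁.le]; linarith), hKB])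
  let c : A.carrier × EuclideanHalfSpace 1 → V := fun z => ⟨cA z, hVA z⟩
  have hc (z) : OrientedAt (halfModel p) (prodOrient A.or) oV c z := by
    have : c = corestrict (c z) cA := by
      funext y
      exact Subtype.ext (coe_corestrict (hVA y)).symm
    rw [this]
    exact (hcA z).corestrict hoV (hVA z)
  refine ⟨Filling.ofCollar A Q oQ hoQ (q ∘ c) ?_ (fun z => (hq _).comp (hc z)) ?_, L, ?_⟩
  · intro z w h
    rcases (hqq _ _).1 h with h | ⟨b, t, -, h, -⟩
    · exact hiA (congrArg Subtype.val h)
    · exact absurd h (hAB _ _)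
  · ext y
    obtain ⟨v, rfl⟩ := hsurj y
    -- Local diffeomorphisms preserve boundary points; of the boundary of `W` only the part `A`
    -- remains in `V`.
    have h₁ : q v ∈ (halfModel p).boundary Q ↔ v.1 ∈ (halfModel p).boundary W.carrier :=
      ((hq v).diffeo.isBoundaryPoint_iff (by simp)).symm.trans
        ((hoV v).diffeo.isBoundaryPoint_iff (by simp))
    rw [h₁, ← W.collar_boundary]
    constructor
    · rintro ⟨a, h⟩
      rcases (hqq _ _).1 h with rfl | ⟨b, t, -, h, -⟩
      · exact ⟨A.inl B a, rfl⟩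
      · exact absurd h (hAB _ _)
    · rintro ⟨x, h⟩
      revert x
      refine ClosedManifold.sum_cases (fun a h => ⟨a, congrArg q (Subtype.ext h)⟩) fun b h => ?_
      exact absurd ⟨b, h⟩ v.2
  · intro a
    change L (q (c (a, 0))) = _
    rw [hL]
    refine (hk₂ _ ?_).trans (hK (A.inl B a))
    rintro ⟨z, h⟩
    exact hAB _ _ h.symm

end Gluing

section Bordism

open Set Filter

variable {p : ℕ} {T : Type*} [TopologicalSpace T]

/-! ### Isomorphic singular manifolds -/

/-- The singular manifolds `s` and `t` differ by an oriented diffeomorphism of their domains. -/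
def Iso (s t : SingularMfd p T) : Prop :=
  ∃ e : s.dom.carrier → t.dom.carrier, Function.Bijective e ∧
    (∀ x, OrientedAt (𝓡 p) s.dom.or t.dom.or e x) ∧ ∀ x, t.map (e x) = s.map x

namespace Iso

variable {a b c d : SingularMfd p T}

protected theorem refl (a : SingularMfd p T) : Iso a a :=
  ⟨id, Function.bijective_id, orientedAt_id _, fun _ => rfl⟩

protected theorem symm (h : Iso a b) : Iso b a := by
  obtain ⟨e, he, ho, hm⟩ := h
  let g := (Equiv.ofBijective e he).symm
  have hg (x) : g (e x) = x := (Equiv.ofBijective e he).symm_apply_apply x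
  refine ⟨g, g.bijective, fun y => ?_, fun y => ?_⟩ <;> obtain ⟨x, rfl⟩ := he.2 y
  · have : g ∘ e = id := funext hg
    exact (ho x).of_comp_right (this ▸ orientedAt_id _ x)
  · rw [hg, hm]

protected theorem trans (h : Iso a b) (h' : Iso b c) : Iso a c := by
  obtain ⟨e, he, ho, hm⟩ := h
  obtain ⟨e', he', ho', hm'⟩ := h'
  exact ⟨e' ∘ e, he'.comp he, fun x => (ho' _).comp (ho x), fun x => (hm' _).trans (hm x)⟩

theorem neg (h : Iso a b) : Iso a.neg b.neg := by
  obtain ⟨e, he, ho, hm⟩ := h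
  exact ⟨e, he, fun x => (ho x).neg, hm⟩

theorem sum (h : Iso a b) (h' : Iso c d) : Iso (a.sum c) (b.sum d) := by
  obtain ⟨e, he, ho, hm⟩ := h
  obtain ⟨e', he', ho', hm'⟩ := h'
  refine ⟨ClosedManifold.elim (fun x => b.dom.inl d.dom (e x)) (fun x => b.dom.inr d.dom (e' x)),
    he.sumMap he', ClosedManifold.elim_oriented (fun x => (b.dom.inl_oriented d.dom _).comp (ho x))
      fun x => (b.dom.inr_oriented d.dom _).comp (ho' x), ?_⟩
  rintro (x | x)
  exacts [hm x, hm' x]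

theorem sum_comm (a b : SingularMfd p T) : Iso (a.sum b) (b.sum a) := by
  refine ⟨ClosedManifold.elim (b.dom.inr a.dom) (b.dom.inl a.dom),
    (Equiv.sumComm _ _).bijective, ClosedManifold.elim_oriented (b.dom.inr_oriented a.dom)
      (b.dom.inl_oriented a.dom), ?_⟩
  rintro (x | x) <;> rfl

theorem sum_assoc (a b c : SingularMfd p T) : Iso ((a.sum b).sum c) (a.sum (b.sum c)) := by
  have hr (x) := a.dom.inr_oriented (b.dom.sum c.dom) x
  refine ⟨ClosedManifold.elim
    (ClosedManifold.elim (a.dom.inl (b.dom.sum c.dom))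
      (a.dom.inr (b.dom.sum c.dom) ∘ b.dom.inl c.dom))
    (a.dom.inr (b.dom.sum c.dom) ∘ b.dom.inr c.dom),
    (Equiv.sumAssoc _ _ _).bijective, ClosedManifold.elim_oriented (ClosedManifold.elim_oriented
      (a.dom.inl_oriented _) fun x => (hr _).comp (b.dom.inl_oriented c.dom x))
      (fun x => (hr _).comp (b.dom.inr_oriented c.dom x)), ?_⟩
  rintro ((x | x) | x) <;> rfl

theorem sum_sum_sum_comm (a b c d : SingularMfd p T) :
    Iso ((a.sum b).sum (c.sum d)) ((a.sum c).sum (b.sum d)) := by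
  refine (sum_assoc _ _ _).trans (Iso.trans ?_ (sum_assoc _ _ _).symm)
  refine (Iso.refl a).sum ((sum_assoc _ _ _).symm.trans (Iso.trans ?_ (sum_assoc _ _ _)))
  exact (sum_comm b c).sum (Iso.refl d)

theorem orientedAt_id_of_eq {M : ClosedManifold p}
    {o : M.carrier → Orientation ℝ (EuclideanSpace ℝ (Fin p)) (Fin p)} (h : M.or = o)
    (x : M.carrier) : OrientedAt (𝓡 p) M.or o id x := by
  subst h
  exact orientedAt_id _ x

theorem neg_neg (a : SingularMfd p T) : Iso a.neg.neg a :=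
  ⟨fun x => x, Function.bijective_id,
    orientedAt_id_of_eq (M := a.dom.neg.neg) (funext fun x => _root_.neg_neg (a.dom.or x)), fun _ => rfl⟩

theorem neg_sum (a b : SingularMfd p T) : Iso (a.sum b).neg (a.neg.sum b.neg) := by
  refine ⟨fun x => x, Function.bijective_id,
    orientedAt_id_of_eq (M := (a.dom.sum b.dom).neg) (o := (a.dom.neg.sum b.dom.neg).or) (funext ?_),
    fun _ => rfl⟩
  rintro (x | x) <;> rfl

end Iso

theorem Bounds.of_iso {s t : SingularMfd p T} (ht : Bounds t) (h : Iso s t) : Bounds s := by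
  obtain ⟨e, he, ho, hm⟩ := h
  exact ht.congr e he ho hm

/-! ### Oriented bordism of singular manifolds -/

/-- The singular manifolds `s` and `t` are bordant. -/
def Bordant (s t : SingularMfd p T) : Prop := Bounds (s.sum t.neg)

theorem Iso.bordant {s t : SingularMfd p T} (h : Iso s t) : Bordant s t :=
  (bounds_sum_neg s).of_iso ((Iso.refl s).sum h.neg.symm)

namespace Bordant

variable {s t u s' t' : SingularMfd p T}

protected theorem refl (s : SingularMfd p T) : Bordant s s := bounds_sum_neg s

theorem neg (h : Bordant s t) : Bordant s.neg t.neg :=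
  Bounds.of_iso (Bounds.neg h) (Iso.neg_sum s t.neg).symm

protected theorem symm (h : Bordant s t) : Bordant t s :=
  Bounds.of_iso h.neg ((Iso.sum_comm _ _).trans ((Iso.refl _).sum (Iso.neg_neg t).symm))

/-- The union of the two fillings bounds `(s ⊔ -t) ⊔ (t ⊔ -u)`, which rearranges to `(s ⊔ -u) ⊔ (t ⊔
-t)`; gluing removes the last pair. -/
protected theorem trans (h : Bordant s t) (h' : Bordant t u) : Bordant s u := by
  refine Bounds.glue (t := t) ((Bounds.sum h h').of_iso ?_)
  refine Iso.trans ((Iso.refl _).sum (Iso.sum_comm _ _)) ((Iso.sum_sum_sum_comm _ _ _ _).trans ?_)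
  exact (Iso.refl _).sum (Iso.sum_comm _ _)

theorem sum (h : Bordant s s') (h' : Bordant t t') : Bordant (s.sum t) (s'.sum t') :=
  (Bounds.sum h h').of_iso
    (((Iso.refl _).sum (Iso.neg_sum _ _)).trans (Iso.sum_sum_sum_comm _ _ _ _))

end Bordant

/-- The empty closed manifold. -/
def ClosedManifold.empty (p : ℕ) : ClosedManifold p where
  carrier := Empty
  charted := ChartedSpace.empty _ _
  smooth :=
    let _ : ChartedSpace (EuclideanSpace ℝ (Fin p)) Empty := ChartedSpace.empty _ _
    IsManifold.empty _
  orient x := x.elim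
  orient_continuous x := x.elim

/-- The empty singular manifold. -/
def SingularMfd.empty (p : ℕ) (T : Type*) [TopologicalSpace T] : SingularMfd p T where
  dom := ClosedManifold.empty p
  map := ⟨fun x => Empty.elim x, continuous_iff_continuousAt.2 fun x => Empty.elim x⟩

theorem Iso.empty_sum (s : SingularMfd p T) : Iso ((SingularMfd.empty p T).sum s) s := by
  refine Iso.symm ⟨(SingularMfd.empty p T).dom.inr s.dom,
    ⟨ClosedManifold.inr_injective, ?_⟩, (SingularMfd.empty p T).dom.inr_oriented s.dom,
    fun _ => rfl⟩
  rintro (x | x)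
  · exact Empty.elim x
  · exact ⟨x, rfl⟩

/-- The cylinder again, now with both ends regarded as incoming. -/
theorem Bordant.neg_sum_self (s : SingularMfd p T) :
    Bordant (s.neg.sum s) (SingularMfd.empty p T) := by
  have h : Iso (SingularMfd.empty p T).neg (SingularMfd.empty p T) :=
    ⟨id, Function.bijective_id, fun x => Empty.elim x, fun x => Empty.elim x⟩
  exact (bounds_sum_neg s).of_iso ((Iso.sum_comm _ _).trans
    ((h.sum (Iso.sum_comm _ _)).trans (Iso.empty_sum _)))

end Bordism

section NielsenBordism

variable {p : ℕ} {X Z : Type*} [TopologicalSpace X] [TopologicalSpace Z]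

/-! ### Nielsen equivalence as bordism in the homotopy preimage -/

/-- The homotopy preimage of `Y` under `f`: points `x` of `X` and `y` of `Y` with a path from `f x`
to `y`. -/
def HomotopyPreimage (f : C(X, Z)) (Y : Set Z) : Type _ :=
  {e : X × Y × C(unitInterval, Z) // e.2.2 0 = f e.1 ∧ e.2.2 1 = e.2.1}

instance (f : C(X, Z)) (Y : Set Z) : TopologicalSpace (HomotopyPreimage f Y) :=
  instTopologicalSpaceSubtype

/-- The inclusion of the preimage into the homotopy preimage by constant paths. -/
def constPath (f : C(X, Z)) (Y : Set Z) : C(f ⁻¹' Y, HomotopyPreimage f Y) where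
  toFun x := ⟨(x, ⟨f x, x.2⟩, ContinuousMap.const _ (f x)), rfl, rfl⟩
  continuous_toFun := by
    refine Continuous.subtype_mk (continuous_subtype_val.prodMk (Continuous.prodMk ?_ ?_)) _
    · fun_prop
    · exact ContinuousMap.continuous_const'.comp (f.continuous.comp continuous_subtype_val)

/-- By currying, a homotopy from `f H` to `G` is a continuous family of paths indexed by `W`. Being
relative to the boundary means that these paths are constant there, which is the boundary condition
set by `constPath`. -/
theorem nielsenEquiv_iff_bordant {f : C(X, Z)} {Y : Set Z} {s t : SingularMfd p (f ⁻¹' Y)} :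
    NielsenEquiv f Y s t ↔ Bordant (s.push (constPath f Y)) (t.push (constPath f Y)) := by
  constructor
  · rintro ⟨W, H, G, h₀, h₁, g₀, g₁, ⟨F⟩⟩
    let γ : C(W.carrier, C(unitInterval, Z)) :=
      ContinuousMap.curry ⟨fun z => F (z.2, z.1), by fun_prop⟩
    have hγ (w r) : γ w r = F (r, w) := rfl
    let K : C(W.carrier, HomotopyPreimage f Y) :=
      ⟨fun w => ⟨(H w, G w, γ w), by simp [hγ], by simp [hγ]⟩, by
        refine Continuous.subtype_mk ?_ _
        fun_prop⟩
    -- Pushing forward does not change domains, so the same `W` is a filling for the bordism in the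
    -- homotopy preimage.
    refine ⟨W, K, ?_⟩
    rintro (x | x)
    · refine Subtype.ext (Prod.ext (h₀ x) (Prod.ext (Subtype.ext (g₀ x)) (ContinuousMap.ext ?_)))
      intro r
      have := F.eq_fst r (x := W.left x) (Or.inl ⟨x, rfl⟩)
      exact this.trans (congrArg f (h₀ x))
    · refine Subtype.ext (Prod.ext (h₁ x) (Prod.ext (Subtype.ext (g₁ x)) (ContinuousMap.ext ?_)))
      intro r
      have := F.eq_fst r (x := W.right x) (Or.inr ⟨x, rfl⟩)
      exact this.trans (congrArg f (h₁ x))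
  · rintro ⟨W, K, hK⟩
    have hl (x) := hK ((s.dom.inl t.dom.neg) x)
    have hr (x) := hK ((s.dom.inr t.dom.neg) x)
    have hc : Continuous fun w => (K w).1 := continuous_subtype_val.comp K.continuous
    let H : C(W.carrier, X) := ⟨fun w => (K w).1.1, by fun_prop⟩
    let G : C(W.carrier, Y) := ⟨fun w => (K w).1.2.1, by fun_prop⟩
    refine ⟨W, H, G, fun x => congrArg (fun e => e.1.1) (hl x),
      fun x => congrArg (fun e => e.1.1) (hr x), fun x => congrArg (fun e => (e.1.2.1 : Z)) (hl x),
      fun x => congrArg (fun e => (e.1.2.1 : Z)) (hr x), ⟨?_⟩⟩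
    refine ⟨⟨⟨fun z => (K z.2).1.2.2 z.1, by fun_prop⟩, fun w => (K w).2.1, fun w => (K w).2.2⟩, ?_⟩
    rintro r _ (⟨x, rfl⟩ | ⟨x, rfl⟩)
    · exact (congrArg (fun e => e.1.2.2 r) (hl x)).trans
        (congrArg (fun e => f e.1.1) (hl x)).symm
    · exact (congrArg (fun e => e.1.2.2 r) (hr x)).trans
        (congrArg (fun e => f e.1.1) (hr x)).symm

theorem push_sum {A B : Type*} [TopologicalSpace A] [TopologicalSpace B] (k : C(A, B))
    (s t : SingularMfd p A) : (s.sum t).push k = (s.push k).sum (t.push k) := by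
  refine congrArg (SingularMfd.mk (s.dom.sum t.dom)) (ContinuousMap.ext ?_)
  rintro (x | x) <;> rfl

theorem Iso.push {A B : Type*} [TopologicalSpace A] [TopologicalSpace B] (k : C(A, B))
    {s t : SingularMfd p A} (h : Iso s t) : Iso (s.push k) (t.push k) := by
  obtain ⟨e, he, ho, hm⟩ := h
  exact ⟨e, he, ho, fun x => congrArg k (hm x)⟩

/-! ### The abelian group of Nielsen classes -/

variable {f : C(X, Z)} {Y : Set Z}

theorem nielsenEquiv_equivalence : Equivalence (NielsenEquiv f Y (p := p)) where
  refl _ := nielsenEquiv_iff_bordant.2 (Bordant.refl _)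
  symm h := nielsenEquiv_iff_bordant.2 (nielsenEquiv_iff_bordant.1 h).symm
  trans h h' := nielsenEquiv_iff_bordant.2
    ((nielsenEquiv_iff_bordant.1 h).trans (nielsenEquiv_iff_bordant.1 h'))

/-- `Quot` identifies along the generated equivalence relation, which adds nothing because
`NielsenEquiv` is already an equivalence. -/
theorem nielsenClass_eq_iff {s t : SingularMfd p (f ⁻¹' Y)} :
    nielsenClass f Y s = nielsenClass f Y t ↔ NielsenEquiv f Y s t :=
  ⟨fun h => nielsenEquiv_equivalence.eqvGen_iff.1 (Quot.eqvGen_exact h), Quot.sound⟩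

theorem nielsenClass_eq_of_iso {s t : SingularMfd p (f ⁻¹' Y)} (h : Iso s t) :
    nielsenClass f Y s = nielsenClass f Y t :=
  nielsenClass_eq_iff.2 (nielsenEquiv_iff_bordant.2 (h.push _).bordant)

theorem NielsenEquiv.sum {s s' t t' : SingularMfd p (f ⁻¹' Y)} (h : NielsenEquiv f Y s s')
    (h' : NielsenEquiv f Y t t') : NielsenEquiv f Y (s.sum t) (s'.sum t') := by
  rw [nielsenEquiv_iff_bordant] at *
  rw [push_sum, push_sum]
  exact h.sum h'

theorem NielsenEquiv.neg {s t : SingularMfd p (f ⁻¹' Y)} (h : NielsenEquiv f Y s t) :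
    NielsenEquiv f Y s.neg t.neg :=
  nielsenEquiv_iff_bordant.2 (nielsenEquiv_iff_bordant.1 h).neg

/-- Addition of Nielsen classes by disjoint union. -/
abbrev NielsenClasses.instAdd : Add (NielsenClasses f Y p) where
  add := Quot.map₂ SingularMfd.sum
    (fun s _ _ h => (nielsenEquiv_equivalence.refl s).sum h)
    (fun _ _ t h => h.sum (nielsenEquiv_equivalence.refl t))

/-- The Nielsen class of the empty manifold. -/
abbrev NielsenClasses.instZero : Zero (NielsenClasses f Y p) where
  zero := nielsenClass f Y (SingularMfd.empty p _)

/-- Negation of Nielsen classes by reversal of the orientation. -/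
abbrev NielsenClasses.instNeg : Neg (NielsenClasses f Y p) where
  neg := Quot.map SingularMfd.neg fun _ _ h => h.neg

attribute [local instance] NielsenClasses.instAdd NielsenClasses.instZero NielsenClasses.instNeg

/-- Nielsen classes form an abelian group under disjoint union. -/
abbrev NielsenClasses.addCommGroup (f : C(X, Z)) (Y : Set Z) (p : ℕ) :
    AddCommGroup (NielsenClasses f Y p) where
  nsmul := nsmulRec
  zsmul := zsmulRec
  add_assoc := by
    rintro ⟨a⟩ ⟨b⟩ ⟨c⟩
    exact nielsenClass_eq_of_iso (Iso.sum_assoc a b c)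
  zero_add := by
    rintro ⟨a⟩
    exact nielsenClass_eq_of_iso (Iso.empty_sum a)
  add_zero := by
    rintro ⟨a⟩
    exact nielsenClass_eq_of_iso ((Iso.sum_comm _ _).trans (Iso.empty_sum a))
  add_comm := by
    rintro ⟨a⟩ ⟨b⟩
    exact nielsenClass_eq_of_iso (Iso.sum_comm a b)
  neg_add_cancel := by
    rintro ⟨a⟩
    refine nielsenClass_eq_iff.2 (nielsenEquiv_iff_bordant.2 ?_)
    rw [push_sum]
    refine (Bordant.neg_sum_self (a.push (constPath f Y))).trans (Iso.bordant ?_)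
    -- The empty singular manifold of the homotopy preimage is matched with the push-forward of the
    -- one in `C`.
    exact ⟨id, Function.bijective_id, fun x => Empty.elim x, fun x => Empty.elim x⟩

/-! ### The induced homomorphism and its injectivity -/

theorem nielsenClass_add (s t : SingularMfd p (f ⁻¹' Y)) :
    nielsenClass f Y s + nielsenClass f Y t = nielsenClass f Y (s.sum t) := rfl

theorem inducedMap_add {X' Z' : Type*} [TopologicalSpace X'] [TopologicalSpace Z']
    {f' : C(X', Z')} {Y' : Set Z'} (k : C(X, X')) (h : C(Z, Z'))
    (comm : ∀ x, f' (k x) = h (f x)) (hY : Set.MapsTo h Y Y') (a b : NielsenClasses f Y p) :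
    inducedMap k h comm hY p (a + b) = inducedMap k h comm hY p a + inducedMap k h comm hY p b := by
  obtain ⟨s⟩ := a
  obtain ⟨t⟩ := b
  exact congrArg (nielsenClass f' Y') (push_sum _ s t)

/-- Nielsen equivalence for a homotopy of `f`, between singular manifolds at time `0`, implies
Nielsen equivalence for `f`. -/
theorem nielsenEquiv_of_push_inclZero {F : C(unitInterval × X, Z)} (hF : ∀ x, F (0, x) = f x)
    {s t : SingularMfd p (f ⁻¹' Y)}
    (h : NielsenEquiv F Y
      (s.push (preimageMap (inclZero X) (ContinuousMap.id Z) hF (Set.mapsTo_id Y)))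
      (t.push (preimageMap (inclZero X) (ContinuousMap.id Z) hF (Set.mapsTo_id Y)))) :
    NielsenEquiv f Y s t := by
  obtain ⟨W, H, G, h₀, h₁, g₀, g₁, hom⟩ := h
  let H' : C(W.carrier, X) := ⟨fun w => (H w).2, by fun_prop⟩
  refine ⟨W, H', G, fun x => congrArg Prod.snd (h₀ x), fun x => congrArg Prod.snd (h₁ x),
    fun x => (g₀ x).trans (hF _), fun x => (g₁ x).trans (hF _),
    ContinuousMap.HomotopicRel.trans (g := F.comp H) ⟨?_⟩ hom⟩
  have hS : ∀ w ∈ Set.range W.left ∪ Set.range W.right, (H w).1 = 0 := by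
    rintro _ (⟨x, rfl⟩ | ⟨x, rfl⟩)
    exacts [congrArg Prod.fst (h₀ x), congrArg Prod.fst (h₁ x)]
  -- Scaling the time coordinate of `H` by the homotopy parameter joins `f H'`, at time `0`, to `F
  -- H`. On the boundary that coordinate is already `0`, so nothing moves there.
  refine ⟨⟨⟨fun z => F (z.1 * (H z.2).1, (H z.2).2), by fun_prop⟩, fun w => ?_, fun w => ?_⟩, ?_⟩
  · change F (0 * (H w).1, (H w).2) = f (H w).2
    rw [zero_mul, hF]
  · change F (1 * (H w).1, (H w).2) = F (H w)
    rw [one_mul]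
  · intro r w hw
    change F (r * (H w).1, (H w).2) = f (H w).2
    rw [hS w hw, mul_zero, hF]

end NielsenBordism

end

end NielsenBordism


theorem mainTheorem1 {X Z : Type*} [TopologicalSpace X] [TopologicalSpace Z] (Y : Set Z)
    (f : C(X, Z)) (F : C(unitInterval × X, Z)) (hF : ∀ x, F (0, x) = f x) (p : ℕ) :
    ∃ (_ : AddCommGroup (NielsenClasses f Y p)) (_ : AddCommGroup (NielsenClasses F Y p))
      (φ : NielsenClasses f Y p →+ NielsenClasses F Y p),
      (∀ s t : SingularMfd p (f ⁻¹' Y),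
        nielsenClass f Y s + nielsenClass f Y t = nielsenClass f Y (s.sum t)) ∧
      (∀ s t : SingularMfd p (F ⁻¹' Y),
        nielsenClass F Y s + nielsenClass F Y t = nielsenClass F Y (s.sum t)) ∧
      (∀ a, φ a = inducedMap (inclZero X) (ContinuousMap.id Z) hF (Set.mapsTo_id Y) p a) ∧
      Function.Injective φ := by
  refine ⟨NielsenClasses.addCommGroup f Y p, NielsenClasses.addCommGroup F Y p,
    let _ := NielsenClasses.addCommGroup f Y p
    let _ := NielsenClasses.addCommGroup F Y p
    AddMonoidHom.mk' _
    (inducedMap_add (inclZero X) (ContinuousMap.id Z) hF (Set.mapsTo_id Y)),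
    nielsenClass_add, nielsenClass_add, fun _ => rfl, ?_⟩
  rintro ⟨s⟩ ⟨t⟩ h
  exact Quot.sound (nielsenEquiv_of_push_inclZero hF (nielsenClass_eq_iff.1 h))
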